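/- Let $\tau\in\mathbb{C}$ with $\operatorname{Im}(\tau)>0$. Write $q=\exp(2\pi i\tau)$, $\widetilde q=\exp(-2\pi i/\tau)$ and, for $u\in\mathbb{C}$, $q^u=\exp(2\pi i\tau u)$, $\widetilde q^{\,u}=\exp(-2\pi i u/\tau)$. For $|b|<1$ put $(a;b)_\infty=\prod_{j=0}^\infty(1-ab^j)$ and $(a_1,\ldots,a_m;b)_\infty=\prod_{i=1}^m(a_i;b)_\infty$; an argument containing $\pm$ stands for the two arguments with the two choices of sign, e.g. $(aq^{\pm x};q)_\infty=(aq^{x};q)_\infty(aq^{-x};q)_\infty$ and $(a\exp(\pm2\pi ix);\widetilde q)_\infty=(a\exp(2\pi ix);\widetilde q)_\infty(a\exp(-2\pi ix);\widetilde q)_\infty$. Let $\sqrt{\cdot}$ be the principal branch of the square root. Let $s_j,t_k\in\mathbb{C}$ $(j,k=1,\ldots,4)$ satisfy $|q^{-3}s_1s_2s_3s_4|<1$ and $|t_k|<1$ $(k=1,\ldots,4)$. Then the following integral over $\mathbb{R}$ converges absolutely (the integrand is defined except at the nonzero integers and the half-odd integers, a set of measure zero), and $$\int_{-\infty}^{\infty}\frac{\bigl(\exp(\pm2\pi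 ix),\,-\exp(\pm2\pi ix),\,\widetilde q^{\,1/2}\exp(\pm2\pi ix);\widetilde q\bigr)_\infty}{\bigl(q^{1\pm x},\,-q^{1\pm x},\,q^{\frac12\pm x};q\bigr)_\infty}\prod_{j=1}^4\frac{\bigl(s_jq^{\pm x};q\bigr)_\infty}{\bigl(t_j\exp(\pm2\pi ix);\widetilde q\bigr)_\infty}\,q^{x^2/2}\,dx$$ $$=\frac{2}{\sqrt{-i\tau}}\,\frac{\bigl(t_1t_2t_3t_4;\widetilde q\bigr)_\infty}{\bigl(q^{-3}s_1s_2s_3s_4;q\bigr)_\infty}\prod_{1\le k<m\le4}\frac{\bigl(q^{-1}s_ks_m;q\bigr)_\infty}{\bigl(t_kt_m;\widetilde q\bigr)_\infty}.$$ -/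

import Mathlib

open scoped BigOperators

noncomputable section

namespace FusedAW

/-- The infinite `q`-Pochhammer symbol `(a; b)_∞ = ∏_{j ≥ 0} (1 - a b^j)`, used for `|b| < 1`. -/
def qPoch (a b : ℂ) : ℂ := ∏' j : ℕ, (1 - a * b ^ j)

/-- For `|b| < 1` the product defining `qPoch a b` converges (unconditionally). -/
theorem multipliable_qPoch (a b : ℂ) (hb : ‖b‖ < 1) :
    Multipliable fun j : ℕ => 1 - a * b ^ j := by
  have h : Summable fun j : ℕ => ‖-(a * b ^ j)‖ := by
    simpa [norm_mul, norm_pow] using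
      (summable_geometric_of_lt_one (norm_nonneg b) hb).mul_left ‖a‖
  simpa [sub_eq_add_neg] using multipliable_one_add_of_summable h

/-- The power `q^u = exp(2πiτu)` of the base `q = exp(2πiτ)`. -/
def qPow (τ u : ℂ) : ℂ := Complex.exp (2 * Real.pi * Complex.I * τ * u)

/-- The power `q̃^u = exp(-2πiu/τ)` of the base `q̃ = exp(-2πi/τ)`. -/
def qtPow (τ u : ℂ) : ℂ := Complex.exp (-(2 * Real.pi * Complex.I * u) / τ)

/-- The base `q = exp(2πiτ)`. -/
def q (τ : ℂ) : ℂ := qPow τ 1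

/-- The base `q̃ = exp(-2πi/τ)`. -/
def qt (τ : ℂ) : ℂ := qtPow τ 1

/-- The exponential `e(x) = exp(2πix)`. -/
def e (x : ℂ) : ℂ := Complex.exp (2 * Real.pi * Complex.I * x)

/-- `(a q^{±x}; q)_∞ = (a q^x; q)_∞ (a q^{-x}; q)_∞`. -/
def qPochPM (τ a x : ℂ) : ℂ :=
  qPoch (a * qPow τ x) (q τ) * qPoch (a * qPow τ (-x)) (q τ)

/-- `(a exp(±2πix); q̃)_∞ = (a exp(2πix); q̃)_∞ (a exp(-2πix); q̃)_∞`. -/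
def qtPochPM (τ a x : ℂ) : ℂ :=
  qPoch (a * e x) (qt τ) * qPoch (a * e (-x)) (qt τ)

/-- The integrand of the fused Askey–Wilson integral. On the real line the displayed quotient is
undefined only on the discrete set of nonzero integers and half-odd integers. -/
def integrand (τ : ℂ) (s t : Fin 4 → ℂ) (x : ℝ) : ℂ :=
  (qtPochPM τ 1 x * qtPochPM τ (-1) x * qtPochPM τ (qtPow τ (1 / 2)) x) /
    (qPochPM τ (qPow τ 1) x * qPochPM τ (-qPow τ 1) x * qPochPM τ (qPow τ (1 / 2)) x) *
  (∏ j, qPochPM τ (s j) x / qtPochPM τ (t j) x) *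
  qPow τ ((x : ℂ) ^ 2 / 2)

end FusedAW

end

/-!
The integrand is a product of a Gaussian-type weight in `q^x` and a `1`-periodic function of
`e^{2πix}`. Write `z = q^x` and `w = e^{2πix}`. The quotient of products that does not involve `s`
and `t` is a quotient of three theta functions in base `q̃` by their three modular transforms in base
`q`, so it is elementary: up to a constant, and after including `q^{x²/2}`, it equals
`(z - 1/z) (w - 1/w) q^{2x²}` (`prefactor_eq`). The proportionality of the theta functions holds
because entire functions with these quasi-periods form a line (`theta_eq_zero`), and the cube of the
constant is found from the three half-periods by Euler's identity `euler_qPoch` in both bases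
(`theta_triple`).

The dependence on `s` is then removed as in a first-order proof of Bailey's `₆ψ₆` sum. The difference
`h (x + 1/2) - h (x - 1/2)`, where `h` is the symmetric weight with shifted parameters, is a
combination of the integrands for `s` and for `s` with `s₁` replaced by `q s₁`; it integrates to zero
against a `1`-periodic function (`sIntegral_recurrence`). Iterating this drives the parameters to
`0`, one after the other (`sIntegral_eq`); the passage to the limit rests on the sharp growth bound
`exists_posPoch_exp_le`, which also gives absolute convergence under `|q^{-3}s₁s₂s₃s₄| < 1`.

For `s = 0` the weight is a sum of Gaussians, and the same argument works in the dual direction: the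
translation is by `± 1/(2τ)`, and it is a contour shift through a strip without poles
(`tIntegral_recurrence`). It drives the parameters `t` to `0` (`tIntegral_eq`), which is the
Askey–Wilson integral unfolded to the real line. Both recurrences come from one rational identity,
`four_factor_identity`. What is left is an elementary Gaussian integral (`tIntegral_zero`).
-/

namespace FusedAW
open Filter Topology MeasureTheory

/-! ### Basic properties of the symbol `(a; b)_∞` -/

theorem hasProd_qPoch (a : ℂ) {b : ℂ} (hb : ‖b‖ < 1) :
    HasProd (fun j : ℕ => 1 - a * b ^ j) (qPoch a b) :=
  (multipliable_qPoch a b hb).hasProd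

theorem tendsto_prod_range_qPoch (a : ℂ) {b : ℂ} (hb : ‖b‖ < 1) :
    Tendsto (fun n => ∏ j ∈ Finset.range n, (1 - a * b ^ j)) atTop (𝓝 (qPoch a b)) :=
  (hasProd_qPoch a hb).tendsto_prod_nat

theorem qPoch_zero (b : ℂ) : qPoch 0 b = 1 := by simp [qPoch]

theorem qPoch_eq_mul (a : ℂ) {b : ℂ} (hb : ‖b‖ < 1) :
    qPoch a b = (1 - a) * qPoch (a * b) b := by
  have h : (fun j : ℕ => 1 - a * b * b ^ j) = fun j : ℕ => 1 - a * b ^ (j + 1) := by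
    funext j; ring
  have h2 := multipliable_qPoch (a * b) b hb
  rw [h] at h2
  have := tprod_eq_zero_mul' (f := fun j : ℕ => 1 - a * b ^ j) h2
  simp only [pow_zero, mul_one] at this
  rw [qPoch, this, qPoch, h]

theorem qPoch_ne_zero {a b : ℂ} (hb : ‖b‖ < 1) (h : ∀ j : ℕ, a * b ^ j ≠ 1) :
    qPoch a b ≠ 0 := by
  have := tprod_one_add_ne_zero_of_summable (f := fun j : ℕ => -(a * b ^ j))
    (fun j => by rw [← sub_eq_add_neg, sub_ne_zero]; exact (h j).symm) (by
      simpa [norm_mul, norm_pow] using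
        (summable_geometric_of_lt_one (norm_nonneg b) hb).mul_left ‖a‖)
  simpa [qPoch, sub_eq_add_neg] using this

theorem qPoch_ne_zero_of_norm_lt {a b : ℂ} (hb : ‖b‖ < 1) (ha : ‖a‖ < 1) : qPoch a b ≠ 0 := by
  refine qPoch_ne_zero hb fun j hj => ?_
  have h1 : ‖a * b ^ j‖ < 1 := by
    rw [norm_mul, norm_pow]
    exact mul_lt_one_of_nonneg_of_lt_one_left (norm_nonneg _) ha
      (pow_le_one₀ (norm_nonneg _) hb.le)
  rw [hj, norm_one] at h1
  exact lt_irrefl _ h1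

/-- The symbol `(a; b)_∞` is an entire function of `a`. -/
theorem differentiable_qPoch {b : ℂ} (hb : ‖b‖ < 1) : Differentiable ℂ fun a => qPoch a b := by
  intro a
  set R : ℝ := ‖a‖ + 1
  have hu : Summable fun j : ℕ => R * ‖b‖ ^ j :=
    (summable_geometric_of_lt_one (norm_nonneg b) hb).mul_left R
  have h := hu.hasProdLocallyUniformlyOn_one_add (f := fun (j : ℕ) (a : ℂ) => -(a * b ^ j))
    (Metric.isOpen_ball (x := (0 : ℂ)) (ε := R))
    (Eventually.of_forall fun j x hx => by
      rw [norm_neg, norm_mul, norm_pow]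
      have : ‖x‖ < R := by simpa using hx
      gcongr) (fun j => by fun_prop)
  have h2 : DifferentiableOn ℂ (fun a => ∏' j : ℕ, (1 + -(a * b ^ j))) (Metric.ball 0 R) :=
    h.differentiableOn (.of_forall fun _ => by
      simpa [Finset.prod_fn] using DifferentiableOn.finsetProd (fun _ _ => by fun_prop))
      Metric.isOpen_ball
  have h3 := h2.differentiableAt (Metric.isOpen_ball.mem_nhds (show a ∈ Metric.ball 0 R by
    simp [R]))
  simpa [qPoch, sub_eq_add_neg] using h3

theorem continuous_qPoch {b : ℂ} (hb : ‖b‖ < 1) : Continuous fun a => qPoch a b :=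
  (differentiable_qPoch hb).continuous

theorem exists_norm_inv_qPoch_le {b : ℂ} (hb : ‖b‖ < 1) {r : ℝ} (hr : r < 1) :
    ∃ C : ℝ, ∀ a : ℂ, ‖a‖ ≤ r → ‖(qPoch a b)⁻¹‖ ≤ C := by
  obtain ⟨C, hC⟩ := (isCompact_closedBall (0 : ℂ) r).exists_bound_of_continuousOn
    (f := fun a => (qPoch a b)⁻¹) ((continuous_qPoch hb).continuousOn.inv₀ fun a ha =>
      qPoch_ne_zero_of_norm_lt hb (lt_of_le_of_lt (by simpa using ha) hr))
  exact ⟨C, fun a ha => hC a (by simpa using ha)⟩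

theorem qPoch_mul_qPoch_neg (a : ℂ) {b : ℂ} (hb : ‖b‖ < 1) :
    qPoch a b * qPoch (-a) b = qPoch (a ^ 2) (b ^ 2) := by
  rw [qPoch, qPoch, ← (multipliable_qPoch a b hb).tprod_mul (multipliable_qPoch (-a) b hb), qPoch]
  congr 1; funext j; ring

theorem qPoch_mul_qPoch_mul_base (a : ℂ) {b : ℂ} (hb : ‖b‖ < 1) :
    qPoch a (b ^ 2) * qPoch (a * b) (b ^ 2) = qPoch a b := by
  have hb2 : ‖b ^ 2‖ < 1 := by
    rw [norm_pow]; exact pow_lt_one₀ (norm_nonneg _) hb two_ne_zero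
  have h1 : (fun k : ℕ => 1 - a * b ^ (2 * k)) = fun k : ℕ => 1 - a * (b ^ 2) ^ k := by
    funext k; rw [pow_mul]
  have h2 : (fun k : ℕ => 1 - a * b ^ (2 * k + 1)) = fun k : ℕ => 1 - a * b * (b ^ 2) ^ k := by
    funext k; rw [pow_succ, pow_mul]; ring
  have := tprod_even_mul_odd (f := fun k : ℕ => 1 - a * b ^ k)
    (by rw [h1]; exact multipliable_qPoch _ _ hb2) (by rw [h2]; exact multipliable_qPoch _ _ hb2)
  rw [h1, h2] at this
  exact this

/-- Euler's identity between partitions into distinct parts and into odd parts, with base `p²`. -/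
theorem euler_qPoch {p : ℂ} (hp : ‖p‖ < 1) :
    qPoch (-p ^ 2) (p ^ 2) * (qPoch p (p ^ 2) * qPoch (-p) (p ^ 2)) = 1 := by
  have hp2 : ‖p ^ 2‖ < 1 := by
    rw [norm_pow]; exact pow_lt_one₀ (norm_nonneg _) hp two_ne_zero
  have hp4 : ‖(p ^ 2) ^ 2‖ < 1 := by
    rw [norm_pow]; exact pow_lt_one₀ (norm_nonneg _) hp2 two_ne_zero
  have h1 := qPoch_mul_qPoch_neg p hp2
  have h2 := qPoch_mul_qPoch_neg (p ^ 2) hp2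
  have h3 := qPoch_mul_qPoch_mul_base (p ^ 2) hp2
  rw [← pow_two (p ^ 2)] at h3
  have h4 : qPoch ((p ^ 2) ^ 2) ((p ^ 2) ^ 2) ≠ 0 := qPoch_ne_zero_of_norm_lt hp4 hp4
  rw [h1]
  apply mul_right_cancel₀ h4
  rw [one_mul]
  linear_combination qPoch (-p ^ 2) (p ^ 2) * h3 + h2

/-! ### A real majorant and growth estimates -/

/-- The real product `∏_{k ≥ 0} (1 + r Q^k)`, which majorizes `(a; b)_∞` when `‖a‖ ≤ r` and
`‖b‖ = Q`. -/
noncomputable def posPoch (r Q : ℝ) : ℝ := ∏' k : ℕ, (1 + r * Q ^ k)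

section PosPoch
variable {Q : ℝ}

theorem multipliable_posPoch (r : ℝ) (hQ : 0 ≤ Q) (hQ1 : Q < 1) :
    Multipliable fun k : ℕ => 1 + r * Q ^ k :=
  multipliable_one_add_of_summable (by
    simpa [norm_mul, norm_pow, abs_of_nonneg hQ] using
      (summable_geometric_of_lt_one hQ hQ1).mul_left ‖r‖)

theorem tendsto_prod_range_posPoch (r : ℝ) (hQ : 0 ≤ Q) (hQ1 : Q < 1) :
    Tendsto (fun n => ∏ j ∈ Finset.range n, (1 + r * Q ^ j)) atTop (𝓝 (posPoch r Q)) :=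
  (multipliable_posPoch r hQ hQ1).hasProd.tendsto_prod_nat

theorem posPoch_eq_mul (r : ℝ) (hQ : 0 ≤ Q) (hQ1 : Q < 1) :
    posPoch r Q = (1 + r) * posPoch (r * Q) Q := by
  have h : (fun j : ℕ => 1 + r * Q * Q ^ j) = fun j : ℕ => 1 + r * Q ^ (j + 1) := by
    funext j; ring
  have h2 := multipliable_posPoch (r * Q) hQ hQ1
  rw [h] at h2
  have := tprod_eq_zero_mul' (f := fun j : ℕ => 1 + r * Q ^ j) h2
  simp only [pow_zero, mul_one] at this
  rw [posPoch, this, posPoch, h]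

theorem posPoch_mono {r r' : ℝ} (hQ : 0 ≤ Q) (hQ1 : Q < 1) (hr : 0 ≤ r) (h : r ≤ r') :
    posPoch r Q ≤ posPoch r' Q :=
  le_of_tendsto_of_tendsto' (tendsto_prod_range_posPoch r hQ hQ1)
    (tendsto_prod_range_posPoch r' hQ hQ1) fun n =>
      Finset.prod_le_prod (fun j _ => by positivity) fun j _ => by gcongr

theorem one_le_posPoch {r : ℝ} (hQ : 0 ≤ Q) (hQ1 : Q < 1) (hr : 0 ≤ r) : 1 ≤ posPoch r Q := by
  simpa [posPoch] using posPoch_mono hQ hQ1 le_rfl hr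

theorem norm_qPoch_le (a : ℂ) {b : ℂ} (hb : ‖b‖ < 1) : ‖qPoch a b‖ ≤ posPoch ‖a‖ ‖b‖ :=
  le_of_tendsto_of_tendsto' (tendsto_prod_range_qPoch a hb).norm
    (tendsto_prod_range_posPoch _ (norm_nonneg b) hb) fun n => by
      rw [norm_prod]
      refine Finset.prod_le_prod (fun j _ => norm_nonneg _) fun j _ => ?_
      refine (norm_sub_le _ _).trans (by simp)

theorem continuous_posPoch (hQ : 0 ≤ Q) (hQ1 : Q < 1) : Continuous fun r => posPoch r Q := by
  rw [continuous_iff_continuousAt]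
  intro a
  set R : ℝ := |a| + 1
  have hu : Summable fun j : ℕ => R * Q ^ j := (summable_geometric_of_lt_one hQ hQ1).mul_left R
  have h := hu.hasProdLocallyUniformlyOn_one_add (f := fun (j : ℕ) (r : ℝ) => r * Q ^ j)
    (Metric.isOpen_ball (x := (0 : ℝ)) (ε := R))
    (Eventually.of_forall fun j x hx => by
      rw [norm_mul, norm_pow, Real.norm_of_nonneg hQ]
      have : ‖x‖ < R := by simpa using hx
      gcongr) (fun j => by fun_prop)
  have h2 : ContinuousOn (fun r => ∏' j : ℕ, (1 + r * Q ^ j)) (Metric.ball 0 R) :=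
    h.tendstoLocallyUniformlyOn_finsetRange.continuousOn (Frequently.of_forall fun _ => by
      fun_prop)
  exact h2.continuousAt (Metric.isOpen_ball.mem_nhds (show a ∈ Metric.ball 0 R by simp [R]))

end PosPoch

section Growth
open Real

/-- The theta function `(-ρ Q^{-x}, -Q^{x+1}/ρ; Q)_∞ ρ^{-x} Q^{x(x+1)/2}` is periodic in `x`, hence
bounded; this gives the exact growth of `(-ρ Q^{-x}; Q)_∞`. Here `Q = exp (-l)`, `ρ = exp r`. -/
theorem exists_posPoch_exp_le {l : ℝ} (hl : 0 < l) (r : ℝ) :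
    ∃ C : ℝ, 0 ≤ C ∧ ∀ x : ℝ, posPoch (exp (r + l * x)) (exp (-l)) ≤
      C * exp (r * x + l * (x * (x + 1) / 2)) := by
  have hQ : 0 ≤ exp (-l) := (exp_pos _).le
  have hQ1 : exp (-l) < 1 := exp_lt_one_iff.2 (by linarith)
  set f : ℝ → ℝ := fun x => posPoch (exp (r + l * x)) (exp (-l)) *
    posPoch (exp (-r - l * (x + 1))) (exp (-l)) * exp (-(r * x + l * (x * (x + 1) / 2))) with hf
  have hcont : Continuous f := by
    have := continuous_posPoch hQ hQ1
    exact ((this.comp (by fun_prop : Continuous fun x : ℝ => exp (r + l * x))).mul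
      (this.comp (by fun_prop : Continuous fun x : ℝ => exp (-r - l * (x + 1))))).mul (by fun_prop)
  have hper : Function.Periodic f 1 := by
    intro x
    have h1 := posPoch_eq_mul (exp (r + l * (x + 1))) hQ hQ1
    have h2 := posPoch_eq_mul (exp (-r - l * (x + 1))) hQ hQ1
    rw [← exp_add] at h1 h2
    rw [show r + l * (x + 1) + -l = r + l * x by ring] at h1
    rw [show -r - l * (x + 1) + -l = -r - l * (x + 1 + 1) by ring] at h2
    have h3 : exp (-(r * (x + 1) + l * ((x + 1) * (x + 1 + 1) / 2))) =
        exp (-r - l * (x + 1)) * exp (-(r * x + l * (x * (x + 1) / 2))) := by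
      rw [← exp_add]; congr 1; ring
    have h4 : exp (r + l * (x + 1)) * exp (-r - l * (x + 1)) = 1 := by
      rw [← exp_add, ← exp_zero]; congr 1; ring
    simp only [hf]
    rw [h1, h2, h3]
    linear_combination posPoch (exp (r + l * x)) (exp (-l)) *
      posPoch (exp (-r - l * (x + 1 + 1))) (exp (-l)) *
      exp (-(r * x + l * (x * (x + 1) / 2))) * h4
  obtain ⟨C, hC⟩ := (isCompact_Icc (a := (0 : ℝ)) (b := 1)).exists_bound_of_continuousOn
    hcont.continuousOn
  refine ⟨C, (norm_nonneg _).trans (hC 0 (by simp)), fun x => ?_⟩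
  have hfx : f x ≤ C := by
    obtain ⟨y, hy, hxy⟩ := hper.exists_mem_Ico₀ one_pos x
    rw [hxy]
    exact (le_abs_self _).trans (hC y ⟨hy.1, hy.2.le⟩)
  -- The second factor of the theta function is at least `1` and can be dropped.
  have h1 : posPoch (exp (r + l * x)) (exp (-l)) * exp (-(r * x + l * (x * (x + 1) / 2))) ≤ C := by
    refine le_trans ?_ hfx
    simp only [hf]
    gcongr
    exact le_mul_of_one_le_right (zero_le_one.trans (one_le_posPoch hQ hQ1 (exp_pos _).le))
      (one_le_posPoch hQ hQ1 (exp_pos _).le)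
  rw [exp_neg (r * x + l * (x * (x + 1) / 2))] at h1
  rwa [← div_eq_mul_inv, div_le_iff₀ (exp_pos _)] at h1

theorem exists_posPoch_pair_le {l : ℝ} (hl : 0 < l) (r : ℝ) :
    ∃ C : ℝ, 0 ≤ C ∧ ∀ x : ℝ,
      posPoch (exp (r - l * x)) (exp (-l)) * posPoch (exp (r + l * x)) (exp (-l)) ≤
        C * exp ((r + l / 2) * |x| + l * x ^ 2 / 2) := by
  have hQ : 0 ≤ exp (-l) := (exp_pos _).le
  have hQ1 : exp (-l) < 1 := exp_lt_one_iff.2 (by linarith)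
  have hpos : ∀ y, 0 ≤ posPoch (exp y) (exp (-l)) := fun y =>
    zero_le_one.trans (one_le_posPoch hQ hQ1 (exp_pos _).le)
  obtain ⟨C, hC0, hC⟩ := exists_posPoch_exp_le hl r
  have key : ∀ x : ℝ, 0 ≤ x →
      posPoch (exp (r - l * x)) (exp (-l)) * posPoch (exp (r + l * x)) (exp (-l)) ≤
        posPoch (exp r) (exp (-l)) * C * exp ((r + l / 2) * x + l * x ^ 2 / 2) := by
    intro x hx
    rw [mul_assoc]
    refine mul_le_mul (posPoch_mono hQ hQ1 (exp_pos _).le (exp_le_exp.2 ?_)) ?_ (hpos _) (hpos _)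
    · nlinarith
    · refine (hC x).trans_eq ?_
      congr 2; ring
  refine ⟨posPoch (exp r) (exp (-l)) * C, mul_nonneg (hpos _) hC0, fun x => ?_⟩
  rcases le_total 0 x with hx | hx
  · rw [abs_of_nonneg hx]; exact key x hx
  · rw [abs_of_nonpos hx, mul_comm]
    simpa [sub_eq_add_neg] using key (-x) (by linarith)

/-- Positive majorants of possibly vanishing moduli that keep the decay condition strict. -/
theorem exists_exp_bounds {a b c d K : ℝ} (ha : 0 ≤ a) (hb : 0 ≤ b) (hc : 0 ≤ c) (hd : 0 ≤ d)
    (h : a * b * c * d * exp K < 1) :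
    ∃ r₁ r₂ r₃ r₄ : ℝ, a ≤ exp r₁ ∧ b ≤ exp r₂ ∧ c ≤ exp r₃ ∧ d ≤ exp r₄ ∧
      r₁ + r₂ + r₃ + r₄ + K < 0 := by
  have hcont : Tendsto (fun x : ℝ => (a + x) * (b + x) * (c + x) * (d + x) * exp K) (𝓝[>] 0)
      (𝓝 ((a + 0) * (b + 0) * (c + 0) * (d + 0) * exp K)) :=
    (Continuous.tendsto (by fun_prop) 0).mono_left nhdsWithin_le_nhds
  obtain ⟨x, hx1, hx2⟩ := ((hcont.eventually (gt_mem_nhds (by simpa using h))).and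
    self_mem_nhdsWithin).exists
  have hx : 0 < x := hx2
  refine ⟨log (a + x), log (b + x), log (c + x), log (d + x), ?_, ?_, ?_, ?_, ?_⟩
  · rw [exp_log (by positivity)]; linarith
  · rw [exp_log (by positivity)]; linarith
  · rw [exp_log (by positivity)]; linarith
  · rw [exp_log (by positivity)]; linarith
  · rw [← exp_lt_one_iff, exp_add, exp_add, exp_add, exp_add, exp_log (by positivity),
      exp_log (by positivity), exp_log (by positivity), exp_log (by positivity)]
    exact hx1

theorem integrable_exp_neg_mul_abs {k : ℝ} (hk : 0 < k) :
    Integrable fun x : ℝ => exp (-k * |x|) := by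
  rw [← integrableOn_univ, ← Set.Iic_union_Ioi (a := (0 : ℝ))]
  refine IntegrableOn.union ?_ ?_
  · refine (integrableOn_exp_mul_Iic hk 0).congr_fun (fun x hx => ?_) measurableSet_Iic
    simp only [abs_of_nonpos (show x ≤ 0 from hx)]; ring_nf
  · refine (integrableOn_exp_mul_Ioi (neg_lt_zero.2 hk) 0).congr_fun (fun x hx => ?_)
      measurableSet_Ioi
    simp only [abs_of_pos (show 0 < x from hx)]

end Growth

open Complex

/-! ### Powers of `q` and decay of the weight -/

section Powers
variable {τ : ℂ}

theorem qPow_add (u v : ℂ) : qPow τ (u + v) = qPow τ u * qPow τ v := by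
  simp only [qPow, ← Complex.exp_add]; congr 1; ring

theorem qPow_zero : qPow τ 0 = 1 := by simp [qPow]

theorem qPow_ne_zero (u : ℂ) : qPow τ u ≠ 0 := Complex.exp_ne_zero _

theorem qPow_neg (u : ℂ) : qPow τ (-u) = (qPow τ u)⁻¹ := by
  refine eq_inv_of_mul_eq_one_left ?_
  rw [← qPow_add, neg_add_cancel, qPow_zero]

theorem norm_qPow_ofReal (x : ℝ) : ‖qPow τ x‖ = Real.exp (-(2 * Real.pi * τ.im) * x) := by
  rw [qPow, Complex.norm_exp]
  congr 1
  simp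

theorem norm_q : ‖q τ‖ = Real.exp (-(2 * Real.pi * τ.im)) := by
  simpa [q] using norm_qPow_ofReal (τ := τ) 1

theorem norm_q_lt_one (hτ : 0 < τ.im) : ‖q τ‖ < 1 := by
  rw [norm_q, Real.exp_lt_one_iff]
  have := Real.pi_pos
  nlinarith [mul_pos this hτ]

theorem differentiable_qPow : Differentiable ℂ (qPow τ) := by
  unfold qPow; fun_prop

theorem continuous_qPow : Continuous (qPow τ) := differentiable_qPow.continuous

end Powers

section Weight
variable {τ : ℂ}

theorem exists_norm_qPochPM_le (hτ : 0 < τ.im) (r : ℝ) :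
    ∃ C : ℝ, 0 ≤ C ∧ ∀ s : ℂ, ‖s‖ ≤ Real.exp r → ∀ x : ℝ, ‖qPochPM τ s x‖ ≤
      C * Real.exp ((r + 2 * Real.pi * τ.im / 2) * |x| + 2 * Real.pi * τ.im * x ^ 2 / 2) := by
  have hl : 0 < 2 * Real.pi * τ.im := by have := Real.pi_pos; positivity
  obtain ⟨C, hC0, hC⟩ := exists_posPoch_pair_le hl r
  refine ⟨C, hC0, fun s hs x => le_trans ?_ (hC x)⟩
  have hq := norm_q_lt_one hτ
  have key : ∀ y : ℝ, ‖qPoch (s * qPow τ y) (q τ)‖ ≤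
      posPoch (Real.exp (r - 2 * Real.pi * τ.im * y)) (Real.exp (-(2 * Real.pi * τ.im))) := by
    intro y
    refine (norm_qPoch_le _ hq).trans ?_
    rw [norm_q] at hq ⊢
    refine posPoch_mono (Real.exp_pos _).le hq (norm_nonneg _) ?_
    rw [norm_mul, norm_qPow_ofReal, sub_eq_add_neg, Real.exp_add, neg_mul]
    gcongr
  have h2 := key (-x)
  rw [mul_neg, sub_neg_eq_add, ofReal_neg] at h2
  rw [qPochPM, norm_mul]
  exact mul_le_mul (key x) h2 (norm_nonneg _) ((norm_nonneg _).trans (key x))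

/-- The symmetric factor `q^{2x²} (a q^{±x}, b q^{±x}, c q^{±x}, d q^{±x}; q)_∞` of the transformed
integrand. -/
noncomputable def weight (τ a b c d x : ℂ) : ℂ :=
  qPow τ (2 * x ^ 2) * (qPochPM τ a x * qPochPM τ b x * qPochPM τ c x * qPochPM τ d x)

theorem differentiable_qPochPM (hτ : 0 < τ.im) (a : ℂ) : Differentiable ℂ (qPochPM τ a) := by
  unfold qPochPM
  have hd := differentiable_qPoch (norm_q_lt_one hτ)
  have hq := differentiable_qPow (τ := τ)
  exact (hd.comp (by fun_prop : Differentiable ℂ fun x => a * qPow τ x)).mul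
    (hd.comp (by fun_prop : Differentiable ℂ fun x => a * qPow τ (-x)))

theorem continuous_weight (hτ : 0 < τ.im) (a b c d : ℂ) : Continuous (weight τ a b c d) := by
  unfold weight
  have := fun a => (differentiable_qPochPM hτ a).continuous
  have := continuous_qPow (τ := τ)
  fun_prop

theorem exists_norm_weight_le (hτ : 0 < τ.im) (r₁ r₂ r₃ r₄ : ℝ) :
    ∃ C : ℝ, 0 ≤ C ∧ ∀ a b c d : ℂ, ‖a‖ ≤ Real.exp r₁ → ‖b‖ ≤ Real.exp r₂ → ‖c‖ ≤ Real.exp r₃ →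
      ‖d‖ ≤ Real.exp r₄ → ∀ x : ℝ, ‖weight τ a b c d x‖ ≤
        C * Real.exp ((r₁ + r₂ + r₃ + r₄ + 2 * (2 * Real.pi * τ.im)) * |x|) := by
  obtain ⟨C₁, h₁, H₁⟩ := exists_norm_qPochPM_le hτ r₁
  obtain ⟨C₂, h₂, H₂⟩ := exists_norm_qPochPM_le hτ r₂
  obtain ⟨C₃, h₃, H₃⟩ := exists_norm_qPochPM_le hτ r₃
  obtain ⟨C₄, h₄, H₄⟩ := exists_norm_qPochPM_le hτ r₄
  refine ⟨C₁ * C₂ * C₃ * C₄, by positivity, fun a b c d ha hb hc hd x => ?_⟩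
  have hx : ‖qPow τ (2 * (x : ℂ) ^ 2)‖ = Real.exp (-(2 * Real.pi * τ.im) * (2 * x ^ 2)) := by
    rw [← norm_qPow_ofReal]; push_cast; rfl
  rw [weight, norm_mul, norm_mul, norm_mul, norm_mul, hx]
  calc _ ≤ Real.exp (-(2 * Real.pi * τ.im) * (2 * x ^ 2)) *
        ((C₁ * Real.exp ((r₁ + 2 * Real.pi * τ.im / 2) * |x| + 2 * Real.pi * τ.im * x ^ 2 / 2)) *
        (C₂ * Real.exp ((r₂ + 2 * Real.pi * τ.im / 2) * |x| + 2 * Real.pi * τ.im * x ^ 2 / 2)) *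
        (C₃ * Real.exp ((r₃ + 2 * Real.pi * τ.im / 2) * |x| + 2 * Real.pi * τ.im * x ^ 2 / 2)) *
        (C₄ * Real.exp ((r₄ + 2 * Real.pi * τ.im / 2) * |x| + 2 * Real.pi * τ.im * x ^ 2 / 2))) := by
        gcongr
        exacts [H₁ a ha x, H₂ b hb x, H₃ c hc x, H₄ d hd x]
    _ = C₁ * C₂ * C₃ * C₄ * (Real.exp (-(2 * Real.pi * τ.im) * (2 * x ^ 2)) *
        Real.exp ((r₁ + 2 * Real.pi * τ.im / 2) * |x| + 2 * Real.pi * τ.im * x ^ 2 / 2) *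
        Real.exp ((r₂ + 2 * Real.pi * τ.im / 2) * |x| + 2 * Real.pi * τ.im * x ^ 2 / 2) *
        Real.exp ((r₃ + 2 * Real.pi * τ.im / 2) * |x| + 2 * Real.pi * τ.im * x ^ 2 / 2) *
        Real.exp ((r₄ + 2 * Real.pi * τ.im / 2) * |x| + 2 * Real.pi * τ.im * x ^ 2 / 2)) := by ring
    _ = _ := by
        simp only [← Real.exp_add]
        congr 2; ring

/-- Uniform exponential decay of the weight times a function of growth at most `|q|^{-m|x|}`; it
holds as soon as `|q^{-2-m} A B C D| < 1`, uniformly for parameters bounded by `A, B, C, D`. -/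
theorem exists_norm_weight_mul_le (hτ : 0 < τ.im) {m : ℝ} {A B C D : ℝ} (hA : 0 ≤ A) (hB : 0 ≤ B)
    (hC : 0 ≤ C) (hD : 0 ≤ D) (h : A * B * C * D * Real.exp (2 * Real.pi * τ.im * (2 + m)) < 1)
    {φ : ℝ → ℂ} {M : ℝ} (hφ : ∀ x, ‖φ x‖ ≤ M * Real.exp (2 * Real.pi * τ.im * m * |x|)) :
    ∃ K k : ℝ, 0 < k ∧ ∀ a b c d : ℂ, ‖a‖ ≤ A → ‖b‖ ≤ B → ‖c‖ ≤ C → ‖d‖ ≤ D → ∀ x : ℝ,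
      ‖weight τ a b c d x * φ x‖ ≤ K * Real.exp (-k * |x|) := by
  obtain ⟨r₁, r₂, r₃, r₄, ha, hb, hc, hd, hr⟩ := exists_exp_bounds hA hB hC hD h
  obtain ⟨C', hC', H⟩ := exists_norm_weight_le hτ r₁ r₂ r₃ r₄
  refine ⟨C' * M, -(r₁ + r₂ + r₃ + r₄ + 2 * Real.pi * τ.im * (2 + m)), by linarith,
    fun a b c d ha' hb' hc' hd' x => ?_⟩
  rw [norm_mul]
  refine (mul_le_mul (H a b c d (ha'.trans ha) (hb'.trans hb) (hc'.trans hc) (hd'.trans hd) x)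
    (hφ x) (norm_nonneg _) (by positivity)).trans_eq ?_
  rw [mul_mul_mul_comm, ← Real.exp_add]
  congr 2; ring

theorem integrable_weight_mul (hτ : 0 < τ.im) {m : ℝ} {a b c d : ℂ}
    (h : ‖a * b * c * d‖ * Real.exp (2 * Real.pi * τ.im * (2 + m)) < 1)
    {φ : ℝ → ℂ} (hcont : Continuous φ) {M : ℝ}
    (hφ : ∀ x, ‖φ x‖ ≤ M * Real.exp (2 * Real.pi * τ.im * m * |x|)) :
    Integrable fun x : ℝ => weight τ a b c d x * φ x := by
  rw [norm_mul, norm_mul, norm_mul] at h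
  obtain ⟨K, k, hk, H⟩ := exists_norm_weight_mul_le hτ (norm_nonneg a) (norm_nonneg b)
    (norm_nonneg c) (norm_nonneg d) h hφ
  refine ((integrable_exp_neg_mul_abs hk).const_mul K).mono' ?_
    (Eventually.of_forall fun x => H a b c d le_rfl le_rfl le_rfl le_rfl x)
  exact (((continuous_weight hτ a b c d).comp continuous_ofReal).mul hcont).aestronglyMeasurable

end Weight

/-! ### Removal of the parameters `s` -/

section SIntegral
variable {τ : ℂ}

theorem qPochPM_add_half (hτ : 0 < τ.im) (α x : ℂ) :
    qPochPM τ (qPow τ (1 / 2) * α) (x + 1 / 2) =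
      (1 - α * qPow τ (-x)) * qPochPM τ (q τ * α) x := by
  have h1 : qPow τ (1 / 2) * qPow τ (1 / 2) = q τ := by rw [← qPow_add, q]; norm_num
  have h2 : qPow τ (1 / 2) * qPow τ (-(1 / 2)) = 1 := by rw [← qPow_add, add_neg_cancel, qPow_zero]
  have h := qPoch_eq_mul (α * qPow τ (-x)) (norm_q_lt_one hτ)
  simp only [qPochPM]
  rw [neg_add, qPow_add, qPow_add,
    show qPow τ (1 / 2) * α * (qPow τ x * qPow τ (1 / 2)) = q τ * α * qPow τ x by
      rw [← h1]; ring,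
    show qPow τ (1 / 2) * α * (qPow τ (-x) * qPow τ (-(1 / 2))) = α * qPow τ (-x) by
      linear_combination α * qPow τ (-x) * h2, h,
    show α * qPow τ (-x) * q τ = q τ * α * qPow τ (-x) by ring]
  ring

theorem qPochPM_neg (a x : ℂ) : qPochPM τ a (-x) = qPochPM τ a x := by
  rw [qPochPM, qPochPM, neg_neg, mul_comm]

theorem qPochPM_sub_half (hτ : 0 < τ.im) (α x : ℂ) :
    qPochPM τ (qPow τ (1 / 2) * α) (x - 1 / 2) =
      (1 - α * qPow τ x) * qPochPM τ (q τ * α) x := by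
  rw [← qPochPM_neg, neg_sub, sub_eq_neg_add, add_comm, add_comm (1 / 2), qPochPM_add_half hτ,
    qPochPM_neg, neg_neg]

theorem qPochPM_eq_mul (hτ : 0 < τ.im) (α x : ℂ) :
    qPochPM τ α x = (1 - α * qPow τ x) * (1 - α * qPow τ (-x)) * qPochPM τ (q τ * α) x := by
  simp only [qPochPM]
  rw [qPoch_eq_mul (α * qPow τ x) (norm_q_lt_one hτ),
    qPoch_eq_mul (α * qPow τ (-x)) (norm_q_lt_one hτ), mul_right_comm α, mul_comm α,
    mul_right_comm α (qPow τ (-x)), mul_comm α]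
  ring

theorem weight_add_half (hτ : 0 < τ.im) (α β γ δ x : ℂ) :
    weight τ (qPow τ (1 / 2) * α) (qPow τ (1 / 2) * β) (qPow τ (1 / 2) * γ) (qPow τ (1 / 2) * δ)
      (x + 1 / 2) = qPow τ (1 / 2) * qPow τ x ^ 2 * ((1 - α * qPow τ (-x)) *
        (1 - β * qPow τ (-x)) * (1 - γ * qPow τ (-x)) * (1 - δ * qPow τ (-x))) *
        weight τ (q τ * α) (q τ * β) (q τ * γ) (q τ * δ) x := by
  simp only [weight, qPochPM_add_half hτ]
  have : qPow τ (2 * (x + 1 / 2) ^ 2) = qPow τ (2 * x ^ 2) * (qPow τ (1 / 2) * qPow τ x ^ 2) := by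
    rw [pow_two (qPow τ x), ← qPow_add, ← qPow_add, ← qPow_add]; congr 1; ring
  rw [this]; ring

theorem weight_sub_half (hτ : 0 < τ.im) (α β γ δ x : ℂ) :
    weight τ (qPow τ (1 / 2) * α) (qPow τ (1 / 2) * β) (qPow τ (1 / 2) * γ) (qPow τ (1 / 2) * δ)
      (x - 1 / 2) = qPow τ (1 / 2) * qPow τ (-x) ^ 2 * ((1 - α * qPow τ x) *
        (1 - β * qPow τ x) * (1 - γ * qPow τ x) * (1 - δ * qPow τ x)) *
        weight τ (q τ * α) (q τ * β) (q τ * γ) (q τ * δ) x := by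
  simp only [weight, qPochPM_sub_half hτ]
  have : qPow τ (2 * (x - 1 / 2) ^ 2) =
      qPow τ (2 * x ^ 2) * (qPow τ (1 / 2) * qPow τ (-x) ^ 2) := by
    rw [pow_two (qPow τ (-x)), ← qPow_add, ← qPow_add, ← qPow_add]; congr 1; ring
  rw [this]; ring

/-- The rational identity behind both first-moment recurrences: an Askey–Wilson type divided
difference of a product of four linear factors. -/
theorem four_factor_identity {z y : ℂ} (h : z * y = 1) (α β γ δ : ℂ) :
    (z - y) * ((1 - α * β * γ * δ) * ((1 - α * z) * (1 - α * y)) -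
      (1 - α * β) * (1 - α * γ) * (1 - α * δ)) =
    -α * (z ^ 2 * ((1 - α * y) * (1 - β * y) * (1 - γ * y) * (1 - δ * y)) -
      y ^ 2 * ((1 - α * z) * (1 - β * z) * (1 - γ * z) * (1 - δ * z))) := by
  have hz : z ≠ 0 := left_ne_zero_of_mul_eq_one h
  obtain rfl : y = z⁻¹ := eq_inv_of_mul_eq_one_right h
  field_simp
  ring

theorem norm_qPow_sub_le (hτ : 0 < τ.im) (x : ℝ) :
    ‖qPow τ x - qPow τ (-x)‖ ≤ 2 * Real.exp (2 * Real.pi * τ.im * 1 * |x|) := by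
  have hl : 0 < 2 * Real.pi * τ.im := by have := Real.pi_pos; positivity
  have h : ∀ y : ℝ, |y| = |x| → ‖qPow τ y‖ ≤ Real.exp (2 * Real.pi * τ.im * 1 * |x|) := by
    intro y hy
    rw [norm_qPow_ofReal, Real.exp_le_exp, ← hy]
    nlinarith [neg_abs_le y]
  have h1 := h x rfl
  have h2 := h (-x) (abs_neg x)
  rw [ofReal_neg] at h2
  exact (norm_sub_le _ _).trans (by linarith)

/-- The integral over `ℝ` of `(q^x - q^{-x}) q^{2x²} ∏ (s q^{±x}; q)_∞` against `g`. -/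
noncomputable def sIntegral (τ : ℂ) (g : ℝ → ℂ) (a b c d : ℂ) : ℂ :=
  ∫ x : ℝ, weight τ a b c d x * ((qPow τ x - qPow τ (-x)) * g x)

variable {g : ℝ → ℂ} {M : ℝ}

theorem norm_qPow_sub_mul_le (hτ : 0 < τ.im) (hgM : ∀ x, ‖g x‖ ≤ M) (x : ℝ) :
    ‖(qPow τ x - qPow τ (-x)) * g x‖ ≤ 2 * M * Real.exp (2 * Real.pi * τ.im * 1 * |x|) := by
  rw [norm_mul, mul_right_comm]
  exact mul_le_mul (norm_qPow_sub_le hτ x) (hgM x) (norm_nonneg _) (by positivity)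

theorem norm_qPow_neg_three : ‖qPow τ (-3)‖ = Real.exp (2 * Real.pi * τ.im * (2 + 1)) := by
  have := norm_qPow_ofReal (τ := τ) (-3)
  push_cast at this
  rw [this]; congr 1; ring

theorem integrable_sIntegral (hτ : 0 < τ.im) (hg : Continuous g) (hgM : ∀ x, ‖g x‖ ≤ M)
    {a b c d : ℂ} (h : ‖qPow τ (-3) * (a * b * c * d)‖ < 1) :
    Integrable fun x : ℝ => weight τ a b c d x * ((qPow τ x - qPow τ (-x)) * g x) := by
  rw [norm_mul, norm_qPow_neg_three, mul_comm] at h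
  refine integrable_weight_mul hτ h ?_ (norm_qPow_sub_mul_le hτ hgM)
  have := continuous_qPow (τ := τ)
  fun_prop

theorem norm_weight_half_lt (α β γ δ : ℂ) (h : ‖α * β * γ * δ‖ < 1) :
    ‖qPow τ (1 / 2) * α * (qPow τ (1 / 2) * β) * (qPow τ (1 / 2) * γ) * (qPow τ (1 / 2) * δ)‖ *
      Real.exp (2 * Real.pi * τ.im * (2 + 0)) < 1 := by
  have h1 : qPow τ (1 / 2) * α * (qPow τ (1 / 2) * β) * (qPow τ (1 / 2) * γ) *
      (qPow τ (1 / 2) * δ) = qPow τ (2 : ℝ) * (α * β * γ * δ) := by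
    have : qPow τ (2 : ℝ) = qPow τ (1 / 2) * qPow τ (1 / 2) * qPow τ (1 / 2) * qPow τ (1 / 2) := by
      simp only [← qPow_add]; norm_num
    rw [this]; ring
  rw [h1, norm_mul, norm_qPow_ofReal, mul_right_comm, ← Real.exp_add]
  ring_nf
  simpa using h

/-- First-order recurrence in one of the parameters. Up to a factor, the difference of the two
integrands is `h (x + 1/2) - h (x - 1/2)` times a `1`-periodic function, where `h` is the weight
with parameters `q^{1/2}α, …, q^{1/2}δ`. -/
theorem sIntegral_recurrence_aux (hτ : 0 < τ.im) (hg : Continuous g)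
    (hgM : ∀ x, ‖g x‖ ≤ M) (hper : Function.Periodic g 1) {α β γ δ : ℂ}
    (h : ‖α * β * γ * δ‖ < 1) :
    (1 - α * β * γ * δ) * sIntegral τ g α (q τ * β) (q τ * γ) (q τ * δ) =
      (1 - α * β) * (1 - α * γ) * (1 - α * δ) *
        sIntegral τ g (q τ * α) (q τ * β) (q τ * γ) (q τ * δ) := by
  have hq3 : qPow τ (-3) * (q τ * q τ * q τ) = 1 := by
    simp only [q, ← qPow_add]; norm_num [qPow_zero]
  have i1 := integrable_sIntegral hτ hg hgM (a := α) (b := q τ * β) (c := q τ * γ) (d := q τ * δ)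
    (by rwa [show qPow τ (-3) * (α * (q τ * β) * (q τ * γ) * (q τ * δ)) = α * β * γ * δ by
      linear_combination α * β * γ * δ * hq3])
  have i2 := integrable_sIntegral hτ hg hgM (a := q τ * α) (b := q τ * β) (c := q τ * γ)
    (d := q τ * δ)
    (by
      rw [show qPow τ (-3) * (q τ * α * (q τ * β) * (q τ * γ) * (q τ * δ)) =
        q τ * (α * β * γ * δ) by linear_combination q τ * α * β * γ * δ * hq3, norm_mul]
      have := norm_q_lt_one hτ
      exact mul_lt_one_of_nonneg_of_lt_one_left (norm_nonneg _) this h.le)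
  set p := qPow τ (1 / 2) with hp
  have hp0 : p ≠ 0 := qPow_ne_zero _
  set H : ℝ → ℂ := fun x => weight τ (p * α) (p * β) (p * γ) (p * δ) x * g (x - 1 / 2) with hH
  have hHi : Integrable H := by
    refine integrable_weight_mul (M := M) hτ (norm_weight_half_lt α β γ δ h) (by fun_prop)
      fun x => ?_
    simpa using hgM (x - 1 / 2)
  have hsub : ∀ x : ℝ,
      (1 - α * β * γ * δ) * (weight τ α (q τ * β) (q τ * γ) (q τ * δ) x *
        ((qPow τ x - qPow τ (-x)) * g x)) -
      (1 - α * β) * (1 - α * γ) * (1 - α * δ) *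
        (weight τ (q τ * α) (q τ * β) (q τ * γ) (q τ * δ) x *
        ((qPow τ x - qPow τ (-x)) * g x)) = -α * p⁻¹ * (H (x + 1 / 2) - H (x - 1 / 2)) := by
    intro x
    have e1 := weight_add_half hτ α β γ δ x
    have e2 := weight_sub_half hτ α β γ δ x
    have hzy : qPow τ x * qPow τ (-x) = 1 := by rw [← qPow_add, add_neg_cancel, qPow_zero]
    have key := four_factor_identity hzy α β γ δ
    have e3 : weight τ α (q τ * β) (q τ * γ) (q τ * δ) x = (1 - α * qPow τ x) *
        (1 - α * qPow τ (-x)) * weight τ (q τ * α) (q τ * β) (q τ * γ) (q τ * δ) x := by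
      simp only [weight]; rw [qPochPM_eq_mul hτ α]; ring
    have e4 : g (x - 1 / 2 - 1 / 2) = g x := by
      rw [← hper (x - 1 / 2 - 1 / 2)]; congr 1; ring
    simp only [hH]
    push_cast
    rw [e1, e2, e3, e4, add_sub_cancel_right, ← hp]
    generalize weight τ (q τ * α) (q τ * β) (q τ * γ) (q τ * δ) x = W
    linear_combination W * g x * key + α * (qPow τ x ^ 2 * ((1 - α * qPow τ (-x)) *
      (1 - β * qPow τ (-x)) * (1 - γ * qPow τ (-x)) * (1 - δ * qPow τ (-x))) -
      qPow τ (-x) ^ 2 * ((1 - α * qPow τ x) * (1 - β * qPow τ x) * (1 - γ * qPow τ x) *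
      (1 - δ * qPow τ x))) * W * g x * inv_mul_cancel₀ hp0
  have h0 : ∫ x : ℝ, -α * p⁻¹ * (H (x + 1 / 2) - H (x - 1 / 2)) = 0 := by
    rw [integral_const_mul, integral_sub (hHi.comp_add_right _) (hHi.comp_sub_right _),
      integral_add_right_eq_self, integral_sub_right_eq_self, sub_self, mul_zero]
  simp_rw [← hsub] at h0
  rw [integral_sub (i1.const_mul _) (i2.const_mul _), integral_const_mul, integral_const_mul,
    sub_eq_zero] at h0
  exact h0

theorem sIntegral_recurrence (hτ : 0 < τ.im) (hg : Continuous g)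
    (hgM : ∀ x, ‖g x‖ ≤ M) (hper : Function.Periodic g 1) {a b c d : ℂ}
    (h : ‖qPow τ (-3) * (a * b * c * d)‖ < 1) :
    (1 - qPow τ (-3) * (a * b * c * d)) * sIntegral τ g a b c d =
      (1 - qPow τ (-1) * a * b) * (1 - qPow τ (-1) * a * c) * (1 - qPow τ (-1) * a * d) *
        sIntegral τ g (a * q τ) b c d := by
  have h3 : qPow τ (-3) = qPow τ (-1) * qPow τ (-1) * qPow τ (-1) := by
    simp only [← qPow_add]; norm_num
  have h1 : ∀ y, q τ * (qPow τ (-1) * y) = y := fun y => by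
    rw [← mul_assoc, q, ← qPow_add, add_neg_cancel, qPow_zero, one_mul]
  have e : qPow τ (-3) * (a * b * c * d) =
      a * (qPow τ (-1) * b) * (qPow τ (-1) * c) * (qPow τ (-1) * d) := by rw [h3]; ring
  have := sIntegral_recurrence_aux hτ hg hgM hper (e ▸ h)
  rw [h1, h1, h1, ← e] at this
  rw [this, mul_comm a (q τ)]
  ring

theorem sIntegral_iterate (hτ : 0 < τ.im) (hg : Continuous g)
    (hgM : ∀ x, ‖g x‖ ≤ M) (hper : Function.Periodic g 1) {a b c d : ℂ}
    (h : ‖qPow τ (-3) * (a * b * c * d)‖ < 1) (n : ℕ) :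
    (∏ k ∈ Finset.range n, (1 - qPow τ (-3) * (a * b * c * d) * q τ ^ k)) * sIntegral τ g a b c d =
      (∏ k ∈ Finset.range n, (1 - qPow τ (-1) * a * b * q τ ^ k)) *
      (∏ k ∈ Finset.range n, (1 - qPow τ (-1) * a * c * q τ ^ k)) *
      (∏ k ∈ Finset.range n, (1 - qPow τ (-1) * a * d * q τ ^ k)) *
        sIntegral τ g (a * q τ ^ n) b c d := by
  induction n with
  | zero => simp
  | succ n ih =>
    have e : qPow τ (-3) * (a * q τ ^ n * b * c * d) =
        qPow τ (-3) * (a * b * c * d) * q τ ^ n := by ring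
    have hn : ‖qPow τ (-3) * (a * q τ ^ n * b * c * d)‖ < 1 := by
      rw [e, norm_mul, norm_pow]
      exact mul_lt_one_of_nonneg_of_lt_one_left (norm_nonneg _) h
        (pow_le_one₀ (norm_nonneg _) (norm_q_lt_one hτ).le)
    have hr := sIntegral_recurrence hτ hg hgM hper hn
    rw [mul_assoc a (q τ ^ n) (q τ), ← pow_succ, e] at hr
    simp only [Finset.prod_range_succ]
    linear_combination (1 - qPow τ (-3) * (a * b * c * d) * q τ ^ n) * ih +
      (∏ k ∈ Finset.range n, (1 - qPow τ (-1) * a * b * q τ ^ k)) *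
      (∏ k ∈ Finset.range n, (1 - qPow τ (-1) * a * c * q τ ^ k)) *
      (∏ k ∈ Finset.range n, (1 - qPow τ (-1) * a * d * q τ ^ k)) * hr

theorem tendsto_mul_q_pow (hτ : 0 < τ.im) (a : ℂ) :
    Tendsto (fun n : ℕ => a * q τ ^ n) atTop (𝓝 0) := by
  simpa using (tendsto_pow_atTop_nhds_zero_of_norm_lt_one (norm_q_lt_one hτ)).const_mul a

theorem tendsto_sIntegral (hτ : 0 < τ.im) (hg : Continuous g)
    (hgM : ∀ x, ‖g x‖ ≤ M) {a b c d : ℂ} (h : ‖qPow τ (-3) * (a * b * c * d)‖ < 1) :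
    Tendsto (fun n : ℕ => sIntegral τ g (a * q τ ^ n) b c d) atTop
      (𝓝 (sIntegral τ g 0 b c d)) := by
  have hφ : Continuous fun x : ℝ => (qPow τ x - qPow τ (-x)) * g x := by
    have := continuous_qPow (τ := τ)
    fun_prop
  rw [norm_mul, norm_qPow_neg_three, mul_comm, norm_mul, norm_mul, norm_mul] at h
  obtain ⟨K, k, hk, H⟩ := exists_norm_weight_mul_le hτ (norm_nonneg a) (norm_nonneg b)
    (norm_nonneg c) (norm_nonneg d) h (norm_qPow_sub_mul_le hτ hgM)
  refine tendsto_integral_of_dominated_convergence (fun x => K * Real.exp (-k * |x|))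
    (fun n => ?_) ((integrable_exp_neg_mul_abs hk).const_mul K) (fun n => ?_) ?_
  · exact (((continuous_weight hτ _ b c d).comp continuous_ofReal).mul hφ).aestronglyMeasurable
  · refine Eventually.of_forall fun x => H _ b c d ?_ le_rfl le_rfl le_rfl x
    rw [norm_mul, norm_pow]
    exact mul_le_of_le_one_right (norm_nonneg _)
      (pow_le_one₀ (norm_nonneg _) (norm_q_lt_one hτ).le)
  · refine Eventually.of_forall fun x => Tendsto.mul_const _ ?_
    have hc := continuous_qPoch (norm_q_lt_one hτ)
    have : Continuous fun a => weight τ a b c d x := by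
      unfold weight qPochPM
      fun_prop
    exact (this.tendsto 0).comp (tendsto_mul_q_pow hτ a)

/-- One parameter can be replaced by `0`: the limit of the iterated recurrence. -/
theorem sIntegral_eq_zero_left (hτ : 0 < τ.im) (hg : Continuous g)
    (hgM : ∀ x, ‖g x‖ ≤ M) (hper : Function.Periodic g 1) {a b c d : ℂ}
    (h : ‖qPow τ (-3) * (a * b * c * d)‖ < 1) :
    qPoch (qPow τ (-3) * (a * b * c * d)) (q τ) * sIntegral τ g a b c d =
      qPoch (qPow τ (-1) * a * b) (q τ) * qPoch (qPow τ (-1) * a * c) (q τ) *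
      qPoch (qPow τ (-1) * a * d) (q τ) * sIntegral τ g 0 b c d := by
  have hq := norm_q_lt_one hτ
  refine tendsto_nhds_unique ((tendsto_prod_range_qPoch _ hq).mul_const _) ?_
  simp_rw [sIntegral_iterate hτ hg hgM hper h]
  exact (((tendsto_prod_range_qPoch _ hq).mul (tendsto_prod_range_qPoch _ hq)).mul
    (tendsto_prod_range_qPoch _ hq)).mul (tendsto_sIntegral hτ hg hgM h)

theorem weight_rotate (a b c d x : ℂ) : weight τ a b c d x = weight τ b c d a x := by
  simp only [weight]; ring

theorem sIntegral_rotate (a b c d : ℂ) : sIntegral τ g a b c d = sIntegral τ g b c d a := by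
  simp only [sIntegral, weight_rotate a b c d]

/-- Integrated form of Bailey's `₆ψ₆` sum. -/
theorem sIntegral_eq (hτ : 0 < τ.im) (hg : Continuous g)
    (hgM : ∀ x, ‖g x‖ ≤ M) (hper : Function.Periodic g 1) {a b c d : ℂ}
    (h : ‖qPow τ (-3) * (a * b * c * d)‖ < 1) :
    qPoch (qPow τ (-3) * (a * b * c * d)) (q τ) * sIntegral τ g a b c d =
      qPoch (qPow τ (-1) * a * b) (q τ) * qPoch (qPow τ (-1) * a * c) (q τ) *
      qPoch (qPow τ (-1) * a * d) (q τ) * (qPoch (qPow τ (-1) * b * c) (q τ) *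
      qPoch (qPow τ (-1) * b * d) (q τ) * qPoch (qPow τ (-1) * c * d) (q τ)) *
        sIntegral τ g 0 0 0 0 := by
  have h1 := sIntegral_eq_zero_left hτ hg hgM hper h
  have h2 := sIntegral_eq_zero_left hτ hg hgM hper (a := b) (b := c) (c := d) (d := 0) (by simp)
  have h3 := sIntegral_eq_zero_left hτ hg hgM hper (a := c) (b := d) (c := 0) (d := 0) (by simp)
  have h4 := sIntegral_eq_zero_left hτ hg hgM hper (a := d) (b := 0) (c := 0) (d := 0) (by simp)
  simp only [mul_zero, qPoch_zero, one_mul, mul_one] at h2 h3 h4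
  rw [h1, sIntegral_rotate 0, h2, sIntegral_rotate 0, h3, sIntegral_rotate 0, h4]
  ring

end SIntegral

/-! ### Contour shifts in a strip and the base `q̃` -/

section Contour

theorem integrable_add_of_strip {F : ℂ → ℂ} {Y C k : ℝ} (hk : 0 < k)
    (hd : ∀ z : ℂ, |z.im| ≤ Y → DifferentiableAt ℂ F z)
    (hb : ∀ z : ℂ, |z.im| ≤ Y → ‖F z‖ ≤ C * Real.exp (-k * |z.re|)) {δ : ℂ} (hδ : |δ.im| ≤ Y) :
    Integrable fun x : ℝ => F (x + δ) := by
  refine (((integrable_exp_neg_mul_abs hk).const_mul C).comp_add_right δ.re).mono' ?_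
    (Eventually.of_forall fun x => by simpa using hb (x + δ) (by simpa using hδ))
  refine Continuous.aestronglyMeasurable ?_
  rw [continuous_iff_continuousAt]
  intro x
  exact ContinuousAt.comp (f := fun x : ℝ => (x + δ : ℂ))
    (hd _ (by simpa using hδ)).continuousAt (by fun_prop)

/-- Translation invariance of the integral over a horizontal line, for a function that is
holomorphic and exponentially decaying in a strip. -/
theorem integral_add_eq_of_strip {F : ℂ → ℂ} {Y C k : ℝ} (hk : 0 < k)
    (hd : ∀ z : ℂ, |z.im| ≤ Y → DifferentiableAt ℂ F z)
    (hb : ∀ z : ℂ, |z.im| ≤ Y → ‖F z‖ ≤ C * Real.exp (-k * |z.re|)) {δ : ℂ} (hδ : |δ.im| ≤ Y) :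
    ∫ x : ℝ, F (x + δ) = ∫ x : ℝ, F x := by
  have hint : ∀ y : ℝ, |y| ≤ Y → Integrable fun x : ℝ => F (x + y * I) := fun y hy =>
    integrable_add_of_strip hk hd hb (by simpa using hy)
  have h1 : ∫ x : ℝ, F (x + δ) = ∫ x : ℝ, F (x + δ.im * I) := by
    rw [← integral_add_right_eq_self (fun x : ℝ => F (x + δ.im * I)) δ.re]
    congr 1; funext x; congr 1
    push_cast
    rw [add_assoc, re_add_im]
  rw [h1]
  set y := δ.im
  have hY : 0 ≤ Y := (abs_nonneg _).trans hδ
  have hrect : ∀ T : ℝ, ∫ x in -T..T, F (x + y * I) = (∫ x in -T..T, F x) +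
      (I * (∫ u in (0 : ℝ)..y, F (T + u * I)) - I * (∫ u in (0 : ℝ)..y, F (-T + u * I))) := by
    intro T
    have := integral_boundary_rect_eq_zero_of_differentiableOn F (-T : ℂ) (T + y * I) (by
      intro z hz
      refine (hd z ?_).differentiableWithinAt
      have hz2 := hz.2
      simp only [Set.mem_preimage, neg_im, ofReal_im, neg_zero, add_im, mul_im, ofReal_re, I_im,
        mul_one, I_re, mul_zero, add_zero, zero_add] at hz2
      have := Set.abs_sub_left_of_mem_uIcc hz2
      simp only [sub_zero] at this
      exact this.trans hδ)
    simp only [neg_re, ofReal_re, neg_im, ofReal_im, neg_zero, ofReal_zero, zero_mul, add_zero,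
      add_re, mul_re, I_re, mul_zero, I_im, sub_self, add_im, mul_im, mul_one,
      zero_add, smul_eq_mul, ofReal_neg] at this
    linear_combination -this
  have hside : ∀ s : ℝ, |s| = 1 →
      Tendsto (fun T : ℝ => ∫ u in (0 : ℝ)..y, F (s * T + u * I)) atTop (𝓝 0) := by
    intro s hs
    refine squeeze_zero_norm' (a := fun T : ℝ => C * Real.exp (-k * T) * |y - 0|) ?_ ?_
    · filter_upwards [eventually_ge_atTop 0] with T hT
      refine intervalIntegral.norm_integral_le_of_norm_le_const fun u hu => ?_
      have hu' := Set.abs_sub_left_of_mem_uIcc (Set.uIoc_subset_uIcc hu)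
      simp only [sub_zero] at hu'
      have := hb (s * T + u * I) (by simpa using hu'.trans hδ)
      simpa [abs_mul, hs, abs_of_nonneg hT] using this
    · have : Tendsto (fun T : ℝ => Real.exp (-k * T)) atTop (𝓝 0) :=
        Real.tendsto_exp_atBot.comp (tendsto_id.const_mul_atTop_of_neg (neg_lt_zero.2 hk))
      simpa using (this.const_mul C).mul_const |y - 0|
  have hA := intervalIntegral_tendsto_integral (hint y hδ) tendsto_neg_atTop_atBot tendsto_id
  have hB := intervalIntegral_tendsto_integral (hint 0 (by simpa using hY))
    tendsto_neg_atTop_atBot tendsto_id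
  simp only [ofReal_zero, zero_mul, add_zero, id] at hA hB
  simp_rw [hrect] at hA
  have h3 := hside 1 (by simp)
  have h4 := hside (-1) (by simp)
  simp only [ofReal_one, one_mul, ofReal_neg, neg_mul] at h3 h4
  have := hB.add ((h3.const_mul I).sub (h4.const_mul I))
  simp only [mul_zero, sub_zero, add_zero] at this
  exact tendsto_nhds_unique hA this

end Contour

section TPowers
variable {τ : ℂ}

theorem e_add (u v : ℂ) : e (u + v) = e u * e v := by
  simp only [e, ← Complex.exp_add]; congr 1; ring

theorem e_zero : e 0 = 1 := by simp [e]

theorem e_mul_e_neg (u : ℂ) : e u * e (-u) = 1 := by rw [← e_add, add_neg_cancel, e_zero]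

theorem e_ne_zero (u : ℂ) : e u ≠ 0 := Complex.exp_ne_zero _

theorem norm_e (z : ℂ) : ‖e z‖ = Real.exp (-(2 * Real.pi * z.im)) := by
  rw [e, Complex.norm_exp]; simp

theorem norm_e_ofReal (x : ℝ) : ‖e x‖ = 1 := by simp [norm_e]

theorem e_add_one (u : ℂ) : e (u + 1) = e u := by
  rw [e_add]; simp [e, Complex.exp_two_pi_mul_I]

theorem differentiable_e : Differentiable ℂ e := by unfold e; fun_prop

theorem qtPow_eq_e (u : ℂ) : qtPow τ u = e (-(u / τ)) := by
  rw [qtPow, e]; congr 1; ring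

theorem qtPow_add (u v : ℂ) : qtPow τ (u + v) = qtPow τ u * qtPow τ v := by
  rw [qtPow_eq_e, qtPow_eq_e, qtPow_eq_e, ← e_add]; congr 1; ring

theorem qtPow_half_mul_self : qtPow τ (1 / 2) * qtPow τ (1 / 2) = qt τ := by
  rw [← qtPow_add, qt]; norm_num

theorem im_inv_neg (hτ : 0 < τ.im) : (1 / (2 * τ)).im < 0 := by
  have h0 : τ ≠ 0 := by rintro rfl; simp at hτ
  rw [one_div, Complex.inv_im]
  refine div_neg_of_neg_of_pos (by simpa using hτ) (by simpa [Complex.normSq_pos] using h0)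

theorem norm_qtPow_half : ‖qtPow τ (1 / 2)‖ = Real.exp (2 * Real.pi * (1 / (2 * τ)).im) := by
  rw [qtPow_eq_e, norm_e]
  congr 1
  rw [show -(1 / 2 / τ) = -(1 / (2 * τ)) by rw [div_div], neg_im]
  ring

theorem norm_qt_lt_one (hτ : 0 < τ.im) : ‖qt τ‖ < 1 := by
  have h : ‖qtPow τ (1 / 2)‖ < 1 := by
    rw [norm_qtPow_half, Real.exp_lt_one_iff]
    have := Real.pi_pos
    nlinarith [mul_pos this (neg_pos.2 (im_inv_neg hτ))]
  rw [← qtPow_half_mul_self, norm_mul]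
  exact mul_lt_one_of_nonneg_of_lt_one_left (norm_nonneg _) h h.le

end TPowers

/-! ### The Askey–Wilson kernel and the Gaussian factor -/

section TKernel
variable {τ : ℂ}

theorem qtPochPM_eq_mul (hτ : 0 < τ.im) (a x : ℂ) :
    qtPochPM τ a x = (1 - a * e x) * (1 - a * e (-x)) * qtPochPM τ (a * qt τ) x := by
  simp only [qtPochPM]
  rw [qPoch_eq_mul (a * e x) (norm_qt_lt_one hτ), qPoch_eq_mul (a * e (-x)) (norm_qt_lt_one hτ),
    mul_right_comm a, mul_right_comm a (e (-x))]
  ring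

theorem qtPochPM_zero (x : ℂ) : qtPochPM τ 0 x = 1 := by simp [qtPochPM, qPoch_zero]

theorem qtPochPM_neg (a x : ℂ) : qtPochPM τ a (-x) = qtPochPM τ a x := by
  rw [qtPochPM, qtPochPM, neg_neg, mul_comm]

theorem qtPochPM_ne_zero (hτ : 0 < τ.im) {a x : ℂ} (h1 : ‖a * e x‖ < 1) (h2 : ‖a * e (-x)‖ < 1) :
    qtPochPM τ a x ≠ 0 :=
  mul_ne_zero (qPoch_ne_zero_of_norm_lt (norm_qt_lt_one hτ) h1)
    (qPoch_ne_zero_of_norm_lt (norm_qt_lt_one hτ) h2)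

theorem differentiable_qtPochPM (hτ : 0 < τ.im) (a : ℂ) : Differentiable ℂ (qtPochPM τ a) := by
  unfold qtPochPM
  have hd := differentiable_qPoch (norm_qt_lt_one hτ)
  have he := differentiable_e
  exact (hd.comp (by fun_prop : Differentiable ℂ fun x => a * e x)).mul
    (hd.comp (by fun_prop : Differentiable ℂ fun x => a * e (-x)))

theorem e_half_period : e (1 / (2 * τ)) = (qtPow τ (1 / 2))⁻¹ := by
  refine eq_inv_of_mul_eq_one_left ?_
  rw [qtPow_eq_e, ← e_add, ← e_zero]; congr 1; rw [div_div]; ring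

theorem qtPochPM_add_half_period (hτ : 0 < τ.im) (a x : ℂ) :
    (1 - a * e (-x)) * qtPochPM τ (qtPow τ (1 / 2) * a) (x + 1 / (2 * τ)) = qtPochPM τ a x := by
  have h1 := e_half_period (τ := τ)
  have hr0 : qtPow τ (1 / 2) ≠ 0 := Complex.exp_ne_zero _
  have h2 : e (-(1 / (2 * τ))) = qtPow τ (1 / 2) := by
    rw [qtPow_eq_e, div_div]
  have h := qPoch_eq_mul (a * e (-x)) (norm_qt_lt_one hτ)
  simp only [qtPochPM]
  rw [neg_add, e_add, e_add, h1, h2, h, ← qtPow_half_mul_self,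
    show qtPow τ (1 / 2) * a * (e x * (qtPow τ (1 / 2))⁻¹) = a * e x by field_simp,
    show qtPow τ (1 / 2) * a * (e (-x) * qtPow τ (1 / 2)) =
      a * e (-x) * (qtPow τ (1 / 2) * qtPow τ (1 / 2)) by ring]
  ring

theorem qtPochPM_sub_half_period (hτ : 0 < τ.im) (a x : ℂ) :
    (1 - a * e x) * qtPochPM τ (qtPow τ (1 / 2) * a) (x - 1 / (2 * τ)) = qtPochPM τ a x := by
  have := qtPochPM_add_half_period hτ a (-x)
  rwa [neg_neg, show -x + 1 / (2 * τ) = -(x - 1 / (2 * τ)) by ring, qtPochPM_neg,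
    qtPochPM_neg] at this

/-- The even Askey–Wilson kernel `1 / (a e^{±2πix}, b e^{±2πix}, c e^{±2πix}, d e^{±2πix}; q̃)_∞`. -/
noncomputable def tKernel (τ a b c d x : ℂ) : ℂ :=
  (qtPochPM τ a x)⁻¹ * (qtPochPM τ b x)⁻¹ * (qtPochPM τ c x)⁻¹ * (qtPochPM τ d x)⁻¹

theorem exists_norm_inv_qtPochPM_le (hτ : 0 < τ.im) {r : ℝ} (hr : r < 1) :
    ∃ C : ℝ, ∀ a x : ℂ, ‖a * e x‖ ≤ r → ‖a * e (-x)‖ ≤ r → ‖(qtPochPM τ a x)⁻¹‖ ≤ C := by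
  obtain ⟨C, hC⟩ := exists_norm_inv_qPoch_le (norm_qt_lt_one hτ) hr
  refine ⟨C * C, fun a x h1 h2 => ?_⟩
  rw [qtPochPM, mul_inv, norm_mul]
  exact mul_le_mul (hC _ h1) (hC _ h2) (norm_nonneg _) ((norm_nonneg _).trans (hC _ h1))

theorem exists_norm_tKernel_le (hτ : 0 < τ.im) {r : ℝ} (hr : r < 1) :
    ∃ C : ℝ, ∀ a b c d x : ℂ, ‖a * e x‖ ≤ r → ‖a * e (-x)‖ ≤ r → ‖b * e x‖ ≤ r →
      ‖b * e (-x)‖ ≤ r → ‖c * e x‖ ≤ r → ‖c * e (-x)‖ ≤ r → ‖d * e x‖ ≤ r → ‖d * e (-x)‖ ≤ r →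
      ‖tKernel τ a b c d x‖ ≤ C := by
  obtain ⟨C, hC⟩ := exists_norm_inv_qtPochPM_le hτ hr
  refine ⟨C * C * C * C, fun a b c d x h1 h2 h3 h4 h5 h6 h7 h8 => ?_⟩
  have hC0 : 0 ≤ C := (norm_nonneg _).trans (hC _ _ h1 h2)
  rw [tKernel, norm_mul, norm_mul, norm_mul]
  gcongr
  exacts [hC _ _ h1 h2, hC _ _ h3 h4, hC _ _ h5 h6, hC _ _ h7 h8]

theorem differentiableAt_tKernel (hτ : 0 < τ.im) {a b c d x : ℂ} (h1 : ‖a * e x‖ < 1)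
    (h2 : ‖a * e (-x)‖ < 1) (h3 : ‖b * e x‖ < 1) (h4 : ‖b * e (-x)‖ < 1) (h5 : ‖c * e x‖ < 1)
    (h6 : ‖c * e (-x)‖ < 1) (h7 : ‖d * e x‖ < 1) (h8 : ‖d * e (-x)‖ < 1) :
    DifferentiableAt ℂ (tKernel τ a b c d) x := by
  have hd := fun a => (differentiable_qtPochPM hτ a) x
  exact ((((hd a).inv (qtPochPM_ne_zero hτ h1 h2)).mul ((hd b).inv (qtPochPM_ne_zero hτ h3 h4))).mul
    ((hd c).inv (qtPochPM_ne_zero hτ h5 h6))).mul ((hd d).inv (qtPochPM_ne_zero hτ h7 h8))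

/-- The periodic factor of the transformed integrand. -/
noncomputable def tPeriodic (τ a b c d : ℂ) (x : ℝ) : ℂ :=
  (e x - e (-x)) * tKernel τ a b c d x

theorem norm_mul_e_ofReal (a : ℂ) (x : ℝ) : ‖a * e x‖ = ‖a‖ := by
  rw [norm_mul, norm_e_ofReal, mul_one]

theorem norm_mul_e_neg_ofReal (a : ℂ) (x : ℝ) : ‖a * e (-x)‖ = ‖a‖ := by
  rw [← ofReal_neg, norm_mul_e_ofReal]

theorem exists_norm_tPeriodic_le (hτ : 0 < τ.im) {r : ℝ} (hr : r < 1) :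
    ∃ C : ℝ, ∀ a b c d : ℂ, ‖a‖ ≤ r → ‖b‖ ≤ r → ‖c‖ ≤ r → ‖d‖ ≤ r → ∀ x : ℝ,
      ‖tPeriodic τ a b c d x‖ ≤ C := by
  obtain ⟨C, hC⟩ := exists_norm_tKernel_le hτ hr
  refine ⟨2 * C, fun a b c d ha hb hc hd x => ?_⟩
  rw [tPeriodic, norm_mul]
  refine mul_le_mul ?_ ?_ (norm_nonneg _) zero_le_two
  · refine (norm_sub_le _ _).trans ?_
    rw [← ofReal_neg, norm_e_ofReal, norm_e_ofReal]; norm_num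
  · apply hC <;> simpa only [norm_mul_e_ofReal, norm_mul_e_neg_ofReal]

theorem continuous_tPeriodic (hτ : 0 < τ.im) {a b c d : ℂ} (ha : ‖a‖ < 1) (hb : ‖b‖ < 1)
    (hc : ‖c‖ < 1) (hd : ‖d‖ < 1) : Continuous (tPeriodic τ a b c d) := by
  have he := differentiable_e.continuous
  refine Continuous.mul (by fun_prop) ?_
  rw [continuous_iff_continuousAt]
  intro x
  refine ContinuousAt.comp (f := fun x : ℝ => (x : ℂ))
    (differentiableAt_tKernel hτ ?_ ?_ ?_ ?_ ?_ ?_ ?_ ?_).continuousAt continuous_ofReal.continuousAt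
  all_goals simpa only [norm_mul_e_ofReal, norm_mul_e_neg_ofReal]

theorem qtPochPM_add_one (a x : ℂ) : qtPochPM τ a (x + 1) = qtPochPM τ a x := by
  have h : e (-(x + 1)) = e (-x) := by rw [← e_add_one (-(x + 1))]; congr 1; ring
  rw [qtPochPM, e_add_one, h, qtPochPM]

theorem periodic_tPeriodic (a b c d : ℂ) : Function.Periodic (tPeriodic τ a b c d) 1 := by
  intro x
  have h : e (-((x : ℂ) + 1)) = e (-x) := by rw [← e_add_one (-((x : ℂ) + 1))]; congr 1; ring
  simp only [tPeriodic, tKernel, ofReal_add, ofReal_one, qtPochPM_add_one, e_add_one, h]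

end TKernel

section GaussCore
variable {τ : ℂ}

/-- The Gaussian factor `q^{2x²} (q^x - q^{-x})` left once all parameters `s` vanish. -/
noncomputable def gaussCore (τ x : ℂ) : ℂ := qPow τ (2 * x ^ 2) * (qPow τ x - qPow τ (-x))

theorem differentiable_gaussCore : Differentiable ℂ (gaussCore τ) := by
  have := differentiable_qPow (τ := τ)
  unfold gaussCore
  fun_prop

theorem sIntegral_zero (g : ℝ → ℂ) : sIntegral τ g 0 0 0 0 = ∫ x : ℝ, gaussCore τ x * g x := by
  simp only [sIntegral, weight, qPochPM, zero_mul, qPoch_zero, mul_one, gaussCore, mul_assoc]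

theorem norm_qPow (u : ℂ) : ‖qPow τ u‖ = Real.exp (-(2 * Real.pi * (τ * u).im)) := by
  rw [qPow, show 2 * Real.pi * I * τ * u = 2 * Real.pi * I * (τ * u) by ring]
  exact norm_e (τ * u)

theorem exists_norm_gaussCore_le (hτ : 0 < τ.im) (Y : ℝ) :
    ∃ C : ℝ, 0 ≤ C ∧ ∀ z : ℂ, |z.im| ≤ Y → ‖gaussCore τ z‖ ≤ C * Real.exp (-1 * |z.re|) := by
  have hπ := Real.pi_pos
  set A := 4 * Real.pi * τ.im with hA
  have hA0 : 0 < A := by positivity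
  set B := 8 * Real.pi * (|τ.re| * Y) + 2 * Real.pi * τ.im with hB
  set D := A * Y ^ 2 + 2 * Real.pi * (|τ.re| * Y) with hD
  refine ⟨2 * Real.exp (D + (B + 1) ^ 2 / (4 * A)), by positivity, fun z hz => ?_⟩
  have hY : 0 ≤ Y := (abs_nonneg _).trans hz
  have hcross : |τ.re * z.im| ≤ |τ.re| * Y := by rw [abs_mul]; gcongr
  have h1 : ‖qPow τ (2 * z ^ 2)‖ ≤
      Real.exp (-A * |z.re| ^ 2 + A * Y ^ 2 + 8 * Real.pi * (|τ.re| * Y) * |z.re|) := by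
    rw [norm_qPow, Real.exp_le_exp]
    have e1 : (τ * (2 * z ^ 2)).im = 2 * (τ.im * (z.re ^ 2 - z.im ^ 2) +
        2 * (τ.re * z.im) * z.re) := by
      simp [pow_two]; ring
    have e2 : -((τ.re * z.im) * z.re) ≤ |τ.re| * Y * |z.re| := by
      refine (neg_le_abs _).trans ?_
      rw [abs_mul]; gcongr
    have e3 : z.im ^ 2 ≤ Y ^ 2 := sq_le_sq' (by linarith [neg_abs_le z.im]) (by
      linarith [le_abs_self z.im])
    rw [e1, sq_abs]
    have e4 := mul_le_mul_of_nonneg_left e2 (by positivity : 0 ≤ 8 * Real.pi)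
    have e5 := mul_le_mul_of_nonneg_left e3 hA0.le
    rw [hA] at e5 ⊢
    nlinarith
  have h2 : ∀ s : ℝ, |s| = 1 → ‖qPow τ (s * z)‖ ≤
      Real.exp (2 * Real.pi * (|τ.re| * Y) + 2 * Real.pi * τ.im * |z.re|) := by
    intro s hs
    rw [norm_qPow, Real.exp_le_exp]
    have e1 : (τ * (s * z)).im = s * (τ.re * z.im) + τ.im * (s * z.re) := by simp; ring
    have e2 : -(s * (τ.re * z.im)) ≤ |τ.re| * Y := by
      refine (neg_le_abs _).trans ?_
      rwa [abs_mul, hs, one_mul]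
    have e3 : -(s * z.re) ≤ |z.re| := by
      refine (neg_le_abs _).trans ?_
      rw [abs_mul, hs, one_mul]
    have e4 := mul_le_mul_of_nonneg_left e3 hτ.le
    rw [e1]
    nlinarith
  have h3 : ‖qPow τ z - qPow τ (-z)‖ ≤
      2 * Real.exp (2 * Real.pi * (|τ.re| * Y) + 2 * Real.pi * τ.im * |z.re|) := by
    have h4 := h2 1 (by simp)
    have h5 := h2 (-1) (by simp)
    simp only [ofReal_one, one_mul, ofReal_neg, neg_mul] at h4 h5
    exact (norm_sub_le _ _).trans (by linarith)
  rw [gaussCore, norm_mul]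
  refine (mul_le_mul h1 h3 (norm_nonneg _) (Real.exp_pos _).le).trans ?_
  rw [mul_left_comm, ← Real.exp_add, mul_assoc 2 (Real.exp _), ← Real.exp_add]
  refine mul_le_mul_of_nonneg_left (Real.exp_le_exp.2 ?_) zero_le_two
  -- completing the square in `|Re z|`
  have hsq : (B + 1) * |z.re| ≤ A * |z.re| ^ 2 + (B + 1) ^ 2 / (4 * A) := by
    have : A * |z.re| ^ 2 + (B + 1) ^ 2 / (4 * A) - (B + 1) * |z.re| =
        (2 * A * |z.re| - (B + 1)) ^ 2 / (4 * A) := by field_simp; ring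
    have h0 : 0 ≤ (2 * A * |z.re| - (B + 1)) ^ 2 / (4 * A) := by positivity
    linarith
  rw [hB] at hsq ⊢
  rw [hD]
  linarith

theorem ne_zero_of_im_pos (hτ : 0 < τ.im) : τ ≠ 0 := by rintro rfl; simp at hτ

theorem gaussCore_add_half_period (hτ : 0 < τ.im) (x : ℂ) :
    gaussCore τ (x + 1 / (2 * τ)) = -(qtPow τ (1 / 2))⁻¹ * e x ^ 2 * gaussCore τ x := by
  have h0 := ne_zero_of_im_pos hτ
  have hq : ∀ u, qPow τ u = e (τ * u) := fun u => by
    rw [qPow, e]; congr 1; ring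
  have hm : e (1 / 2) = -1 := by
    rw [e, show 2 * Real.pi * I * (1 / 2) = Real.pi * I by ring, Complex.exp_pi_mul_I]
  have hm' : e (-(1 / 2)) = -1 := by
    rw [← e_add_one, ← hm]; congr 1; norm_num
  rw [← e_half_period, gaussCore, gaussCore, hq, hq, hq, hq, hq, hq,
    show τ * (2 * (x + 1 / (2 * τ)) ^ 2) = τ * (2 * x ^ 2) + (x + x) + 1 / (2 * τ) by
      field_simp; ring,
    show τ * (x + 1 / (2 * τ)) = τ * x + 1 / 2 by field_simp,
    show τ * -(x + 1 / (2 * τ)) = τ * -x + -(1 / 2) by field_simp; ring]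
  simp only [e_add _ (1 / 2), e_add _ (-(1 / 2)), e_add _ (1 / (2 * τ)), e_add _ (x + x), e_add x x,
    hm, hm']
  ring

theorem gaussCore_neg (x : ℂ) : gaussCore τ (-x) = -gaussCore τ x := by
  simp only [gaussCore, neg_sq, neg_neg]; ring

theorem gaussCore_sub_half_period (hτ : 0 < τ.im) (x : ℂ) :
    gaussCore τ (x - 1 / (2 * τ)) = -(qtPow τ (1 / 2))⁻¹ * e (-x) ^ 2 * gaussCore τ x := by
  have := gaussCore_add_half_period hτ (-x)
  rw [show -x + 1 / (2 * τ) = -(x - 1 / (2 * τ)) by ring, gaussCore_neg, gaussCore_neg] at this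
  linear_combination -this

end GaussCore

/-! ### Removal of the parameters `t` and the Gaussian integral -/

section TIntegral
variable {τ : ℂ}

/-- The integral over `ℝ` left once all parameters `s` vanish; it unfolds the Askey–Wilson integral
over a period. -/
noncomputable def tIntegral (τ a b c d : ℂ) : ℂ :=
  ∫ x : ℝ, gaussCore τ x * tPeriodic τ a b c d x

theorem integrable_gaussCore_mul (hτ : 0 < τ.im) {g : ℝ → ℂ} (hg : Continuous g) {M : ℝ}
    (hgM : ∀ x, ‖g x‖ ≤ M) : Integrable fun x : ℝ => gaussCore τ x * g x := by
  simpa only [weight, qPochPM, zero_mul, qPoch_zero, mul_one, gaussCore, mul_assoc] using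
    integrable_sIntegral hτ hg hgM (a := 0) (b := 0) (c := 0) (d := 0) (by simp)

/-- In the strip `|Im z| ≤ -Im (1/(2τ))` the growth of `e^{2πiz}` is compensated by `q̃^{1/2}`. -/
theorem norm_half_mul_e_le {a z : ℂ} (hz : |z.im| ≤ -(1 / (2 * τ)).im) :
    ‖qtPow τ (1 / 2) * a * e z‖ ≤ ‖a‖ := by
  rw [norm_mul, norm_mul, norm_qtPow_half, norm_e, mul_right_comm, ← Real.exp_add]
  refine mul_le_of_le_one_left (norm_nonneg _) (Real.exp_le_one_iff.2 ?_)
  have h1 := Real.pi_pos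
  have h2 := (neg_abs_le z.im)
  nlinarith

/-- Contour shift by the half-period `1/(2τ)`: no zero of the denominator is met in the strip. -/
theorem integral_half_period_shift (hτ : 0 < τ.im) {a b c d : ℂ} (ha : ‖a‖ < 1) (hb : ‖b‖ < 1)
    (hc : ‖c‖ < 1) (hd : ‖d‖ < 1) :
    let r := qtPow τ (1 / 2)
    let H : ℂ → ℂ := fun x => gaussCore τ x * tKernel τ (r * a) (r * b) (r * c) (r * d) x
    Integrable (fun x : ℝ => H (x + 1 / (2 * τ))) ∧ Integrable (fun x : ℝ => H (x - 1 / (2 * τ))) ∧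
      ∫ x : ℝ, H (x + 1 / (2 * τ)) = ∫ x : ℝ, H (x - 1 / (2 * τ)) := by
  intro r H
  set Y := -(1 / (2 * τ)).im with hY
  have hY0 : 0 < Y := neg_pos.2 (im_inv_neg hτ)
  obtain ⟨C, hC0, hC⟩ := exists_norm_gaussCore_le hτ Y
  obtain ⟨K, hK⟩ := exists_norm_tKernel_le hτ (r := max (max ‖a‖ ‖b‖) (max ‖c‖ ‖d‖))
    (by simp [ha, hb, hc, hd])
  have hneg : ∀ z : ℂ, |z.im| ≤ Y → |(-z).im| ≤ Y := fun z hz => by simpa using hz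
  have hdiff : ∀ z : ℂ, |z.im| ≤ Y → DifferentiableAt ℂ H z := fun z hz =>
    (differentiable_gaussCore z).mul (differentiableAt_tKernel hτ
      ((norm_half_mul_e_le hz).trans_lt ha) ((norm_half_mul_e_le (hneg z hz)).trans_lt ha)
      ((norm_half_mul_e_le hz).trans_lt hb) ((norm_half_mul_e_le (hneg z hz)).trans_lt hb)
      ((norm_half_mul_e_le hz).trans_lt hc) ((norm_half_mul_e_le (hneg z hz)).trans_lt hc)
      ((norm_half_mul_e_le hz).trans_lt hd) ((norm_half_mul_e_le (hneg z hz)).trans_lt hd))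
  have hbound : ∀ z : ℂ, |z.im| ≤ Y → ‖H z‖ ≤ C * K * Real.exp (-1 * |z.re|) := by
    intro z hz
    simp only [H, norm_mul]
    rw [mul_right_comm]
    refine mul_le_mul (hC z hz) (hK _ _ _ _ _ ?_ ?_ ?_ ?_ ?_ ?_ ?_ ?_) (norm_nonneg _)
      (by positivity)
    all_goals first
      | exact (norm_half_mul_e_le hz).trans (by simp)
      | exact (norm_half_mul_e_le (hneg z hz)).trans (by simp)
  have hp : |(1 / (2 * τ)).im| ≤ Y := by rw [hY, abs_of_neg (im_inv_neg hτ)]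
  have hm : |(-(1 / (2 * τ))).im| ≤ Y := by rwa [neg_im, abs_neg]
  simp_rw [sub_eq_add_neg]
  exact ⟨integrable_add_of_strip one_pos hdiff hbound hp,
    integrable_add_of_strip one_pos hdiff hbound hm,
    (integral_add_eq_of_strip one_pos hdiff hbound hp).trans
      (integral_add_eq_of_strip one_pos hdiff hbound hm).symm⟩

theorem one_sub_ne_zero_of_norm_lt {u : ℂ} (h : ‖u‖ < 1) : 1 - u ≠ 0 := by
  rw [sub_ne_zero]
  rintro rfl
  simp at h

theorem inv_qtPochPM_add_half_period (hτ : 0 < τ.im) {a : ℂ} (ha : ‖a‖ < 1) (x : ℝ) :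
    (qtPochPM τ (qtPow τ (1 / 2) * a) (x + 1 / (2 * τ)))⁻¹ =
      (1 - a * e (-x)) * (qtPochPM τ a x)⁻¹ := by
  rw [← qtPochPM_add_half_period hτ a x, mul_inv, mul_inv_cancel_left₀]
  exact one_sub_ne_zero_of_norm_lt (by rwa [norm_mul_e_neg_ofReal])

theorem inv_qtPochPM_sub_half_period (hτ : 0 < τ.im) {a : ℂ} (ha : ‖a‖ < 1) (x : ℝ) :
    (qtPochPM τ (qtPow τ (1 / 2) * a) (x - 1 / (2 * τ)))⁻¹ =
      (1 - a * e x) * (qtPochPM τ a x)⁻¹ := by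
  rw [← qtPochPM_sub_half_period hτ a x, mul_inv, mul_inv_cancel_left₀]
  exact one_sub_ne_zero_of_norm_lt (by rwa [norm_mul_e_ofReal])

theorem inv_qtPochPM_mul_qt (hτ : 0 < τ.im) {a : ℂ} (ha : ‖a‖ < 1) (x : ℝ) :
    (qtPochPM τ (a * qt τ) x)⁻¹ = (1 - a * e x) * (1 - a * e (-x)) * (qtPochPM τ a x)⁻¹ := by
  rw [qtPochPM_eq_mul hτ a x, mul_inv, mul_inv_cancel_left₀]
  exact mul_ne_zero (one_sub_ne_zero_of_norm_lt (by rwa [norm_mul_e_ofReal]))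
    (one_sub_ne_zero_of_norm_lt (by rwa [norm_mul_e_neg_ofReal]))

theorem integrable_tIntegral (hτ : 0 < τ.im) {a b c d : ℂ} (ha : ‖a‖ < 1) (hb : ‖b‖ < 1)
    (hc : ‖c‖ < 1) (hd : ‖d‖ < 1) :
    Integrable fun x : ℝ => gaussCore τ x * tPeriodic τ a b c d x := by
  obtain ⟨K, hK⟩ := exists_norm_tPeriodic_le hτ (r := max (max ‖a‖ ‖b‖) (max ‖c‖ ‖d‖))
    (by simp [ha, hb, hc, hd])
  exact integrable_gaussCore_mul hτ (continuous_tPeriodic hτ ha hb hc hd)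
    (hK a b c d (by simp) (by simp) (by simp) (by simp))

theorem norm_mul_qt_pow_le (hτ : 0 < τ.im) (a : ℂ) (n : ℕ) : ‖a * qt τ ^ n‖ ≤ ‖a‖ := by
  rw [norm_mul, norm_pow]
  exact mul_le_of_le_one_right (norm_nonneg _)
    (pow_le_one₀ (norm_nonneg _) (norm_qt_lt_one hτ).le)

theorem tIntegral_recurrence (hτ : 0 < τ.im) {a b c d : ℂ} (ha : ‖a‖ < 1) (hb : ‖b‖ < 1)
    (hc : ‖c‖ < 1) (hd : ‖d‖ < 1) :
    (1 - a * b * c * d) * tIntegral τ (a * qt τ) b c d =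
      (1 - a * b) * (1 - a * c) * (1 - a * d) * tIntegral τ a b c d := by
  have ha' : ‖a * qt τ‖ < 1 := by simpa using (norm_mul_qt_pow_le hτ a 1).trans_lt ha
  have i1 := integrable_tIntegral hτ ha' hb hc hd
  have i2 := integrable_tIntegral hτ ha hb hc hd
  obtain ⟨j1, j2, hshift⟩ := integral_half_period_shift hτ ha hb hc hd
  set r := qtPow τ (1 / 2) with hr
  have hr0 : r ≠ 0 := Complex.exp_ne_zero _
  -- Both shifted integrands are trigonometric polynomials times the original kernel.
  have hA : ∀ x : ℝ, gaussCore τ (x + 1 / (2 * τ)) *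
      tKernel τ (r * a) (r * b) (r * c) (r * d) (x + 1 / (2 * τ)) =
      -r⁻¹ * (gaussCore τ x * ((e x ^ 2 * ((1 - a * e (-x)) * (1 - b * e (-x)) * (1 - c * e (-x)) *
        (1 - d * e (-x)))) * tKernel τ a b c d x)) := by
    intro x
    rw [gaussCore_add_half_period hτ, tKernel, tKernel, inv_qtPochPM_add_half_period hτ ha,
      inv_qtPochPM_add_half_period hτ hb, inv_qtPochPM_add_half_period hτ hc,
      inv_qtPochPM_add_half_period hτ hd]
    ring
  have hB : ∀ x : ℝ, gaussCore τ (x - 1 / (2 * τ)) *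
      tKernel τ (r * a) (r * b) (r * c) (r * d) (x - 1 / (2 * τ)) =
      -r⁻¹ * (gaussCore τ x * ((e (-x) ^ 2 * ((1 - a * e x) * (1 - b * e x) * (1 - c * e x) *
        (1 - d * e x))) * tKernel τ a b c d x)) := by
    intro x
    rw [gaussCore_sub_half_period hτ, tKernel, tKernel, inv_qtPochPM_sub_half_period hτ ha,
      inv_qtPochPM_sub_half_period hτ hb, inv_qtPochPM_sub_half_period hτ hc,
      inv_qtPochPM_sub_half_period hτ hd]
    ring
  have hsub : ∀ x : ℝ,
      (1 - a * b * c * d) * (gaussCore τ x * tPeriodic τ (a * qt τ) b c d x) -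
      (1 - a * b) * (1 - a * c) * (1 - a * d) * (gaussCore τ x * tPeriodic τ a b c d x) =
      a * r * (gaussCore τ (x + 1 / (2 * τ)) *
          tKernel τ (r * a) (r * b) (r * c) (r * d) (x + 1 / (2 * τ)) -
        gaussCore τ (x - 1 / (2 * τ)) *
          tKernel τ (r * a) (r * b) (r * c) (r * d) (x - 1 / (2 * τ))) := by
    intro x
    have key := four_factor_identity (e_mul_e_neg x) a b c d
    have hK : tKernel τ (a * qt τ) b c d x =
        (1 - a * e x) * (1 - a * e (-x)) * tKernel τ a b c d x := by
      simp only [tKernel, inv_qtPochPM_mul_qt hτ ha]; ring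
    rw [hA, hB, tPeriodic, tPeriodic, hK]
    generalize tKernel τ a b c d x = K
    linear_combination gaussCore τ x * K * key + a * gaussCore τ x * K *
      (e x ^ 2 * ((1 - a * e (-x)) * (1 - b * e (-x)) * (1 - c * e (-x)) * (1 - d * e (-x))) -
      e (-x) ^ 2 * ((1 - a * e x) * (1 - b * e x) * (1 - c * e x) * (1 - d * e x))) *
      mul_inv_cancel₀ hr0
  have h0 := integral_const_mul (μ := volume) (a * r) fun x : ℝ =>
    gaussCore τ (x + 1 / (2 * τ)) * tKernel τ (r * a) (r * b) (r * c) (r * d) (x + 1 / (2 * τ)) -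
    gaussCore τ (x - 1 / (2 * τ)) * tKernel τ (r * a) (r * b) (r * c) (r * d) (x - 1 / (2 * τ))
  rw [integral_sub j1 j2, hshift, sub_self, mul_zero] at h0
  simp_rw [← hsub] at h0
  rw [integral_sub (i1.const_mul _) (i2.const_mul _), integral_const_mul, integral_const_mul,
    sub_eq_zero] at h0
  exact h0

theorem tIntegral_iterate (hτ : 0 < τ.im) {a b c d : ℂ} (ha : ‖a‖ < 1) (hb : ‖b‖ < 1)
    (hc : ‖c‖ < 1) (hd : ‖d‖ < 1) (n : ℕ) :
    (∏ k ∈ Finset.range n, (1 - a * b * c * d * qt τ ^ k)) * tIntegral τ (a * qt τ ^ n) b c d =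
      (∏ k ∈ Finset.range n, (1 - a * b * qt τ ^ k)) *
      (∏ k ∈ Finset.range n, (1 - a * c * qt τ ^ k)) *
      (∏ k ∈ Finset.range n, (1 - a * d * qt τ ^ k)) * tIntegral τ a b c d := by
  induction n with
  | zero => simp
  | succ n ih =>
    have hr := tIntegral_recurrence hτ ((norm_mul_qt_pow_le hτ a n).trans_lt ha) hb hc hd
    rw [mul_assoc a (qt τ ^ n) (qt τ), ← pow_succ] at hr
    simp only [Finset.prod_range_succ]
    linear_combination (1 - a * b * qt τ ^ n) * (1 - a * c * qt τ ^ n) *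
      (1 - a * d * qt τ ^ n) * ih +
      (∏ k ∈ Finset.range n, (1 - a * b * c * d * qt τ ^ k)) * hr

theorem tendsto_tIntegral (hτ : 0 < τ.im) {a b c d : ℂ} (ha : ‖a‖ < 1) (hb : ‖b‖ < 1)
    (hc : ‖c‖ < 1) (hd : ‖d‖ < 1) :
    Tendsto (fun n : ℕ => tIntegral τ (a * qt τ ^ n) b c d) atTop (𝓝 (tIntegral τ 0 b c d)) := by
  obtain ⟨K, hK⟩ := exists_norm_tPeriodic_le hτ (r := max (max ‖a‖ ‖b‖) (max ‖c‖ ‖d‖))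
    (by simp [ha, hb, hc, hd])
  have hn := norm_mul_qt_pow_le hτ a
  refine tendsto_integral_of_dominated_convergence (fun x => ‖gaussCore τ x * (K : ℂ)‖)
    (fun n => (integrable_tIntegral hτ ((hn n).trans_lt ha) hb hc hd).aestronglyMeasurable)
    (integrable_gaussCore_mul hτ continuous_const (fun _ => le_rfl)).norm (fun n => ?_) ?_
  · refine Eventually.of_forall fun x => ?_
    rw [norm_mul, norm_mul]
    refine mul_le_mul_of_nonneg_left ?_ (norm_nonneg _)
    rw [norm_real]
    exact (hK _ b c d ((hn n).trans (by simp)) (by simp) (by simp) (by simp) x).trans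
      (le_abs_self K)
  · refine Eventually.of_forall fun x => Tendsto.const_mul _ ?_
    have hp : Continuous fun a => qtPochPM τ a x := by
      have hq := continuous_qPoch (norm_qt_lt_one hτ)
      unfold qtPochPM
      fun_prop
    have h0 : Tendsto (fun n : ℕ => a * qt τ ^ n) atTop (𝓝 0) := by
      simpa using (tendsto_pow_atTop_nhds_zero_of_norm_lt_one (norm_qt_lt_one hτ)).const_mul a
    have h1 := ((hp.tendsto 0).comp h0).inv₀ (by simp [qtPochPM_zero])
    exact (((h1.mul_const _).mul_const _).mul_const _).const_mul _

/-- One parameter can be replaced by `0`: the limit of the iterated recurrence. -/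
theorem tIntegral_eq_zero_left (hτ : 0 < τ.im) {a b c d : ℂ} (ha : ‖a‖ < 1) (hb : ‖b‖ < 1)
    (hc : ‖c‖ < 1) (hd : ‖d‖ < 1) :
    qPoch (a * b * c * d) (qt τ) * tIntegral τ 0 b c d =
      qPoch (a * b) (qt τ) * qPoch (a * c) (qt τ) * qPoch (a * d) (qt τ) *
        tIntegral τ a b c d := by
  have hq := norm_qt_lt_one hτ
  refine tendsto_nhds_unique ((tendsto_prod_range_qPoch _ hq).mul
    (tendsto_tIntegral hτ ha hb hc hd)) ?_
  simp_rw [tIntegral_iterate hτ ha hb hc hd]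
  exact (((tendsto_prod_range_qPoch _ hq).mul (tendsto_prod_range_qPoch _ hq)).mul
    (tendsto_prod_range_qPoch _ hq)).mul_const _

theorem tIntegral_rotate (a b c d : ℂ) : tIntegral τ a b c d = tIntegral τ b c d a := by
  have h : ∀ x, tKernel τ a b c d x = tKernel τ b c d a x := fun x => by
    simp only [tKernel]; ring
  simp only [tIntegral, tPeriodic, h]

/-- The Askey–Wilson integral, unfolded to the real line. -/
theorem tIntegral_eq (hτ : 0 < τ.im) {a b c d : ℂ} (ha : ‖a‖ < 1) (hb : ‖b‖ < 1)
    (hc : ‖c‖ < 1) (hd : ‖d‖ < 1) :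
    qPoch (a * b) (qt τ) * qPoch (a * c) (qt τ) * qPoch (a * d) (qt τ) *
      (qPoch (b * c) (qt τ) * qPoch (b * d) (qt τ) * qPoch (c * d) (qt τ)) *
        tIntegral τ a b c d = qPoch (a * b * c * d) (qt τ) * tIntegral τ 0 0 0 0 := by
  have h0 : ‖(0 : ℂ)‖ < 1 := by simp
  have h1 := tIntegral_eq_zero_left hτ ha hb hc hd
  have h2 := tIntegral_eq_zero_left hτ hb hc hd h0
  have h3 := tIntegral_eq_zero_left hτ hc hd h0 h0
  have h4 := tIntegral_eq_zero_left hτ hd h0 h0 h0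
  simp only [mul_zero, qPoch_zero, one_mul, mul_one] at h2 h3 h4
  rw [tIntegral_rotate 0] at h1 h2 h3
  linear_combination -(qPoch (b * c) (qt τ) * qPoch (b * d) (qt τ) * qPoch (c * d) (qt τ)) * h1 -
    qPoch (a * b * c * d) (qt τ) * qPoch (c * d) (qt τ) * h2 -
    qPoch (a * b * c * d) (qt τ) * h3 - qPoch (a * b * c * d) (qt τ) * h4

theorem cpow_half_inv_four_mul {w : ℂ} (hw : 0 < w.re) :
    ((4 * w)⁻¹ : ℂ) ^ (1 / 2 : ℂ) = (w ^ (1 / 2 : ℂ))⁻¹ / 2 := by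
  have hw0 : w ≠ 0 := by rintro rfl; simp at hw
  have harg : (4 * w).arg ≠ Real.pi := by
    rw [Ne, Complex.arg_eq_pi_iff]
    rintro ⟨h, -⟩
    simp at h
    linarith
  have h2 : cexp (Real.log 4 * (1 / 2)) = 2 := by
    rw [show (4 : ℝ) = 2 ^ 2 by norm_num, Real.log_pow]
    push_cast
    rw [show (2 : ℂ) * (Real.log 2 : ℝ) * (1 / 2) = (Real.log 2 : ℝ) by ring, ← ofReal_exp,
      Real.exp_log two_pos, ofReal_ofNat]
  rw [Complex.inv_cpow _ _ harg, Complex.cpow_def_of_ne_zero (by simpa using hw0),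
    Complex.cpow_def_of_ne_zero hw0,
    show (4 : ℂ) * w = ((4 : ℝ) : ℂ) * w by push_cast; rfl, Complex.log_ofReal_mul (by norm_num) hw0,
    add_mul, Complex.exp_add, h2, mul_inv]
  ring

theorem integral_gaussian_term (hτ : 0 < τ.im) (u v : ℂ) :
    ∫ x : ℝ, cexp (4 * Real.pi * I * τ * x ^ 2 + 2 * Real.pi * I * (u * τ + v) * x + 0) =
      ((-I * τ) ^ (1 / 2 : ℂ))⁻¹ / 2 * cexp (-(Real.pi * I / 4) * (u * τ + v) ^ 2 / τ) := by
  have hπ := Real.pi_pos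
  have hπ0 : (Real.pi : ℂ) ≠ 0 := by exact_mod_cast hπ.ne'
  have h0 := ne_zero_of_im_pos hτ
  rw [integral_cexp_quadratic (by simp; positivity), ← cpow_half_inv_four_mul (by simpa using hτ)]
  congr 2
  · field_simp
  · field_simp
    ring_nf

theorem tIntegral_zero (hτ : 0 < τ.im) :
    tIntegral τ 0 0 0 0 = -2 * I * cexp (-(Real.pi * I / 4) * (τ + 1 / τ)) /
      (-I * τ) ^ (1 / 2 : ℂ) := by
  have h0 := ne_zero_of_im_pos hτ
  have hb : (4 * Real.pi * I * τ).re < 0 := by simp; positivity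
  have hi := fun u v : ℂ => integrable_cexp_quadratic' hb (2 * Real.pi * I * (u * τ + v)) 0
  have hx : ∀ x : ℝ, gaussCore τ x * tPeriodic τ 0 0 0 0 x =
      cexp (4 * Real.pi * I * τ * x ^ 2 + 2 * Real.pi * I * (1 * τ + 1) * x + 0) -
      cexp (4 * Real.pi * I * τ * x ^ 2 + 2 * Real.pi * I * (1 * τ + -1) * x + 0) -
      (cexp (4 * Real.pi * I * τ * x ^ 2 + 2 * Real.pi * I * (-1 * τ + 1) * x + 0) -
      cexp (4 * Real.pi * I * τ * x ^ 2 + 2 * Real.pi * I * (-1 * τ + -1) * x + 0)) := by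
    intro x
    simp only [gaussCore, tPeriodic, tKernel, qtPochPM_zero, qPow, e, inv_one, mul_one, mul_sub,
      sub_mul, ← Complex.exp_add]
    ring_nf
  have hexp : ∀ u v : ℂ, u ^ 2 = 1 → v ^ 2 = 1 →
      cexp (-(Real.pi * I / 4) * (u * τ + v) ^ 2 / τ) =
      cexp (-(Real.pi * I / 4) * (τ + 1 / τ)) * cexp (-(Real.pi / 2 * I) * (u * v)) := by
    intro u v hu hv
    rw [← Complex.exp_add]
    congr 1
    rw [show (u * τ + v) ^ 2 = u ^ 2 * τ ^ 2 + 2 * (u * v) * τ + v ^ 2 by ring, hu, hv]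
    field_simp
    ring
  have hp : cexp (Real.pi / 2 * I) = I := Complex.exp_pi_div_two_mul_I
  have hm : cexp (-(Real.pi / 2 * I)) = -I := by rw [Complex.exp_neg, hp, inv_I]
  simp only [tIntegral, hx]
  have hi2 : ∀ u : ℂ, Integrable fun x : ℝ =>
      cexp (4 * Real.pi * I * τ * x ^ 2 + 2 * Real.pi * I * (u * τ + 1) * x + 0) -
      cexp (4 * Real.pi * I * τ * x ^ 2 + 2 * Real.pi * I * (u * τ + -1) * x + 0) := fun u =>
    (hi u 1).sub (hi u (-1))
  rw [integral_sub (hi2 1) (hi2 (-1)), integral_sub (hi _ _) (hi _ _),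
    integral_sub (hi _ _) (hi _ _)]
  simp only [integral_gaussian_term hτ]
  rw [hexp 1 1 (by norm_num) (by norm_num), hexp 1 (-1) (by norm_num) (by norm_num),
    hexp (-1) 1 (by norm_num) (by norm_num), hexp (-1) (-1) (by norm_num) (by norm_num)]
  simp only [mul_one, mul_neg, neg_neg, hp, hm]
  ring

end TIntegral

/-! ### Theta functions and their modular transformation -/

section PeriodicFourier

theorem integral_period_shift {G : ℂ → ℂ} (hG : Differentiable ℂ G) (hper : ∀ x, G (x + 1) = G x)
    (c : ℂ) : ∫ x in (0 : ℝ)..1, G (x + c) = ∫ x in (0 : ℝ)..1, G x := by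
  have h1 : ∫ x in (0 : ℝ)..1, G x = ∫ x in (0 : ℝ)..1, G (x + c.im * I) := by
    have := integral_boundary_rect_eq_zero_of_differentiableOn G 0 (1 + c.im * I)
      hG.differentiableOn
    simp only [zero_re, ofReal_re, zero_im, ofReal_im, ofReal_zero, zero_mul, add_zero, one_re,
      add_re, mul_re, I_re, mul_zero, I_im, sub_self, add_im, mul_im, mul_one, one_im, ofReal_one,
      zero_add, smul_eq_mul] at this
    have h2 : ∀ u : ℝ, G (1 + u * I) = G (u * I) := fun u => by rw [add_comm, hper]
    simp only [h2] at this
    linear_combination this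
  rw [h1]
  set F : ℝ → ℂ := fun x => G (x + c.im * I) with hF
  have hFper : Function.Periodic F 1 := fun x => by
    simp only [hF]; rw [← hper (x + c.im * I)]; congr 1; push_cast; ring
  have h2 : ∀ x : ℝ, G (x + c) = F (x + c.re) := fun x => by
    simp only [hF]; congr 1; push_cast; rw [add_assoc, re_add_im]
  simp_rw [h2]
  rw [intervalIntegral.integral_comp_add_right F, zero_add, add_comm 1, show
    ∫ x in (0 : ℝ)..1, F x = ∫ x in (0 : ℝ)..0 + 1, F x by rw [zero_add]]
  exact hFper.intervalIntegral_add_eq _ _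

theorem eq_zero_of_integral_mul_e_eq_zero {f : ℝ → ℂ} (hf : Continuous f)
    (hper : Function.Periodic f 1) (h : ∀ k : ℤ, ∫ x in (0 : ℝ)..1, f x * e (-(k * x)) = 0)
    (x : ℝ) : f x = 0 := by
  let F : C(AddCircle (1 : ℝ), ℂ) := ⟨hper.lift, continuous_coinduced_dom.mpr hf⟩
  have hF : ∀ y : ℝ, F (y : AddCircle (1 : ℝ)) = f y := fun y => hper.lift_coe y
  have hcoef : fourierCoeff F = 0 := by
    funext n
    rw [fourierCoeff_eq_intervalIntegral _ _ 0, Pi.zero_apply, zero_add, ← h n]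
    simp only [hF, fourier_coe_apply, smul_eq_mul, one_div, inv_one, one_smul]
    refine intervalIntegral.integral_congr fun y _ => ?_
    simp only [e]
    rw [mul_comm]
    congr 2
    push_cast
    ring
  have hs := has_pointwise_sum_fourier_series_of_summable (f := F)
    (by rw [hcoef]; exact summable_zero) (x : AddCircle (1 : ℝ))
  rw [hF, hcoef] at hs
  simpa using hs.unique (by simp)

/-- Theta functions of degree one form a line: an entire `1`-periodic function with multiplier
`-e^{-2πix}` along `ω` is determined by its mean over a period. The quasi-periodicity gives a
recurrence between consecutive Fourier coefficients. -/
theorem theta_eq_zero {D : ℂ → ℂ} (hD : Differentiable ℂ D) (hper : ∀ x, D (x + 1) = D x) {ω : ℂ}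
    (hω : ∀ x, D (x + ω) = -e (-x) * D x) (h0 : ∫ x in (0 : ℝ)..1, D x = 0) (c : ℂ) : D c = 0 := by
  set a : ℤ → ℂ := fun k => ∫ x in (0 : ℝ)..1, D x * e (-(k * x)) with ha
  have he := differentiable_e
  have hG : ∀ k : ℤ, Differentiable ℂ fun x => D x * e (-(k * x)) := fun k => by fun_prop
  have heper : ∀ (k : ℤ) (x : ℂ), e (-(k * (x + 1))) = e (-(k * x)) := fun k x => by
    have hk : e (-(k : ℂ)) = 1 := by
      rw [e, show 2 * Real.pi * I * -(k : ℂ) = ((-k : ℤ) : ℂ) * (2 * Real.pi * I) by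
        push_cast; ring, Complex.exp_int_mul_two_pi_mul_I]
    rw [show -(k * (x + 1)) = -(k * x) + -k by ring, e_add, hk, mul_one]
  have hGper : ∀ (k : ℤ) (x : ℂ), D (x + 1) * e (-(k * (x + 1))) = D x * e (-(k * x)) :=
    fun k x => by rw [hper, heper]
  have hrec : ∀ k : ℤ, a k = -e (-(k * ω)) * a (k + 1) := by
    intro k
    have := integral_period_shift (hG k) (hGper k) ω
    rw [ha]
    simp only
    rw [← this, ← intervalIntegral.integral_const_mul]
    congr 1; funext x
    rw [hω, show -(k * ((x : ℂ) + ω)) = -(k * x) + -(k * ω) by ring, e_add,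
      show -(((k + 1 : ℤ) : ℂ) * x) = -(k * x) + -x by push_cast; ring, e_add]
    ring
  have hzero : ∀ k : ℤ, a k = 0 := by
    intro k
    induction k using Int.induction_on with
    | zero => simpa [ha, e_zero] using h0
    | succ n ih =>
      have := hrec n
      rw [ih] at this
      exact (mul_eq_zero.1 this.symm).resolve_left (neg_ne_zero.2 (e_ne_zero _))
    | pred n ih =>
      have := hrec (-n - 1)
      rw [sub_add_cancel, ih, mul_zero] at this
      exact this
  have key := eq_zero_of_integral_mul_e_eq_zero (f := fun x : ℝ => D (x + c))
    (by have := hD.continuous; fun_prop)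
    (fun x => by simp only; rw [← hper (x + c)]; congr 1; push_cast; ring) (fun k => ?_) 0
  · simpa using key
  · have := integral_period_shift (hG k) (hGper k) c
    rw [show ∫ x in (0 : ℝ)..1, D x * e (-(k * x)) = 0 from hzero k] at this
    have h2 : ∀ x : ℝ, D (x + c) * e (-(k * x)) =
        e (k * c) * (D (x + c) * e (-(k * (x + c)))) := fun x => by
      rw [show -(k * (x : ℂ)) = k * c + -(k * (x + c)) by ring, e_add]; ring
    simp_rw [h2]
    rw [intervalIntegral.integral_const_mul, this, mul_zero]

end PeriodicFourier

section Theta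
variable {τ : ℂ}

/-- The modified theta function `(a, b/a; b)_∞`. -/
noncomputable def theta (a b : ℂ) : ℂ := qPoch a b * qPoch (b * a⁻¹) b

theorem theta_mul_base {a b : ℂ} (ha : a ≠ 0) (hb0 : b ≠ 0) (hb : ‖b‖ < 1) :
    theta (b * a) b = -a⁻¹ * theta a b := by
  rw [theta, theta, mul_inv, mul_inv_cancel_left₀ hb0, qPoch_eq_mul a⁻¹ hb, qPoch_eq_mul a hb,
    mul_comm b a, mul_comm b a⁻¹]
  field_simp
  ring

theorem theta_neg_one {b : ℂ} (hb : ‖b‖ < 1) : theta (-1) b = 2 * qPoch (-b) b ^ 2 := by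
  rw [theta, qPoch_eq_mul (-1) hb, inv_neg, inv_one, mul_neg_one, neg_one_mul]; ring

theorem theta_of_sq {p : ℂ} (hp : p ≠ 0) : theta p (p ^ 2) = qPoch p (p ^ 2) ^ 2 := by
  rw [theta, show p ^ 2 * p⁻¹ = p by field_simp]; ring

/-- The theta function in base `q` with the exponential factor that gives it the quasi-periods of
`(e^{2πix}, q̃ e^{-2πix}; q̃)_∞`. -/
noncomputable def dualTheta (τ x : ℂ) : ℂ :=
  cexp (Real.pi * I * (τ * x ^ 2 + (1 - τ) * x)) * theta (qPow τ x) (q τ)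

theorem q_ne_zero : q τ ≠ 0 := qPow_ne_zero _

theorem qt_ne_zero : qt τ ≠ 0 := Complex.exp_ne_zero _

theorem differentiable_theta_e (hτ : 0 < τ.im) : Differentiable ℂ fun x => theta (e x) (qt τ) := by
  have hd := differentiable_qPoch (norm_qt_lt_one hτ)
  have he := differentiable_e
  exact (hd.comp he).mul (hd.comp ((he.inv fun x => e_ne_zero x).const_mul (qt τ)))

theorem differentiable_dualTheta (hτ : 0 < τ.im) : Differentiable ℂ (dualTheta τ) := by
  have hd := differentiable_qPoch (norm_q_lt_one hτ)
  have he := differentiable_qPow (τ := τ)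
  exact (by fun_prop : Differentiable ℂ fun x =>
    cexp (Real.pi * I * (τ * x ^ 2 + (1 - τ) * x))).mul
    ((hd.comp he).mul (hd.comp ((he.inv fun x => qPow_ne_zero x).const_mul (q τ))))

theorem theta_e_add (hτ : 0 < τ.im) (x : ℂ) :
    theta (e (x + -(1 / τ))) (qt τ) = -e (-x) * theta (e x) (qt τ) := by
  rw [add_comm, e_add, show e (-(1 / τ)) = qt τ by rw [qt, qtPow_eq_e],
    theta_mul_base (e_ne_zero x) qt_ne_zero (norm_qt_lt_one hτ),
    show (e x)⁻¹ = e (-x) from inv_eq_of_mul_eq_one_right (e_mul_e_neg x)]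

theorem dualTheta_add_one (hτ : 0 < τ.im) (x : ℂ) : dualTheta τ (x + 1) = dualTheta τ x := by
  have h1 : qPow τ (x + 1) = q τ * qPow τ x := by rw [qPow_add, mul_comm, q]
  have h2 : cexp (Real.pi * I * (τ * (x + 1) ^ 2 + (1 - τ) * (x + 1))) =
      cexp (Real.pi * I * (τ * x ^ 2 + (1 - τ) * x)) * (-1 * qPow τ x) := by
    rw [← Complex.exp_pi_mul_I, qPow, ← Complex.exp_add, ← Complex.exp_add]; congr 1; ring
  rw [dualTheta, h1, theta_mul_base (qPow_ne_zero x) q_ne_zero (norm_q_lt_one hτ), h2, dualTheta]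
  have := qPow_ne_zero (τ := τ) x
  field_simp

theorem dualTheta_add (hτ : 0 < τ.im) (x : ℂ) :
    dualTheta τ (x + -(1 / τ)) = -e (-x) * dualTheta τ x := by
  have h0 := ne_zero_of_im_pos hτ
  have h1 : qPow τ (x + -(1 / τ)) = qPow τ x := by
    rw [qPow, qPow, show 2 * Real.pi * I * τ * (x + -(1 / τ)) =
      2 * Real.pi * I * τ * x - 2 * Real.pi * I by field_simp; ring,
      Complex.exp_sub, Complex.exp_two_pi_mul_I, div_one]
  have h2 : cexp (Real.pi * I * (τ * (x + -(1 / τ)) ^ 2 + (1 - τ) * (x + -(1 / τ)))) =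
      cexp (Real.pi * I * (τ * x ^ 2 + (1 - τ) * x)) * (-1 * e (-x)) := by
    rw [← Complex.exp_pi_mul_I, e, ← Complex.exp_add, ← Complex.exp_add]; congr 1
    field_simp; ring
  rw [dualTheta, h1, h2, dualTheta]
  ring

theorem qPow_half_sq : qPow τ (1 / 2) ^ 2 = q τ := by
  rw [pow_two, ← qPow_add, q]; norm_num

theorem qtPow_half_sq : qtPow τ (1 / 2) ^ 2 = qt τ := by rw [pow_two, qtPow_half_mul_self]

theorem norm_qPow_half_lt_one (hτ : 0 < τ.im) : ‖qPow τ (1 / 2)‖ < 1 := by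
  have := norm_q_lt_one hτ
  rw [← qPow_half_sq, norm_pow] at this
  exact (sq_lt_one_iff₀ (norm_nonneg _)).1 this

theorem norm_qtPow_half_lt_one (hτ : 0 < τ.im) : ‖qtPow τ (1 / 2)‖ < 1 := by
  have := norm_qt_lt_one hτ
  rw [← qtPow_half_sq, norm_pow] at this
  exact (sq_lt_one_iff₀ (norm_nonneg _)).1 this

theorem dualTheta_half (hτ : 0 < τ.im) : dualTheta τ (1 / 2) ≠ 0 := by
  have h := qPoch_ne_zero_of_norm_lt (norm_q_lt_one hτ) (norm_qPow_half_lt_one hτ)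
  refine mul_ne_zero (Complex.exp_ne_zero _) ?_
  rw [← qPow_half_sq] at h ⊢
  rw [theta_of_sq (qPow_ne_zero _)]
  exact pow_ne_zero 2 h

/-- Modular transformation of the theta function, up to a constant. -/
theorem exists_theta_eq_mul_dualTheta (hτ : 0 < τ.im) :
    ∃ κ : ℂ, ∀ x, theta (e x) (qt τ) = κ * dualTheta τ x := by
  set Φ : ℂ → ℂ := fun x => theta (e x) (qt τ)
  set A := ∫ x in (0 : ℝ)..1, Φ x with hA
  set B := ∫ x in (0 : ℝ)..1, dualTheta τ x with hB
  have dΦ : Differentiable ℂ Φ := differentiable_theta_e hτ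
  have dΨ := differentiable_dualTheta hτ
  have hB0 : B ≠ 0 := fun h => dualTheta_half hτ
    (theta_eq_zero dΨ (dualTheta_add_one hτ) (dualTheta_add hτ) h _)
  have key := theta_eq_zero (D := fun x => B * Φ x - A * dualTheta τ x) (by fun_prop)
    (fun x => by simp only [Φ, e_add_one, dualTheta_add_one hτ])
    (fun x => by
      simp only [Φ]
      rw [theta_e_add hτ, dualTheta_add hτ]; ring) (by
      rw [intervalIntegral.integral_sub, intervalIntegral.integral_const_mul,
        intervalIntegral.integral_const_mul, ← hA, ← hB]
      · ring
      · exact (Continuous.intervalIntegrable (by have := dΦ.continuous; fun_prop) _ _)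
      · exact (Continuous.intervalIntegrable (by have := dΨ.continuous; fun_prop) _ _))
  refine ⟨A / B, fun x => ?_⟩
  have := key x
  field_simp
  linear_combination this

theorem e_half : e (1 / 2) = -1 := by
  rw [e, show 2 * Real.pi * I * (1 / 2) = Real.pi * I by ring, Complex.exp_pi_mul_I]

theorem e_neg_half_period : e (-(1 / (2 * τ))) = qtPow τ (1 / 2) := by
  rw [qtPow_eq_e, div_div]

theorem qPow_neg_half_period (hτ : 0 < τ.im) : qPow τ (-(1 / (2 * τ))) = -1 := by
  have h0 := ne_zero_of_im_pos hτ
  rw [qPow, show 2 * Real.pi * I * τ * -(1 / (2 * τ)) = -(Real.pi * I) by field_simp,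
    Complex.exp_neg, Complex.exp_pi_mul_I]
  norm_num

/-- Product of three theta functions at the points `x`, `x + 1/2`, `x - 1/(2τ)`. The constant comes
from the values at the three half-periods, whose product is given by Euler's identity in either
base. -/
theorem theta_triple (hτ : 0 < τ.im) (x : ℂ) :
    theta (e x) (qt τ) * theta (-e x) (qt τ) * theta (qtPow τ (1 / 2) * e x) (qt τ) =
      cexp (Real.pi * I * (3 * τ * x ^ 2 - 2 * τ * x + 2 * x + τ / 4 + 1 / (4 * τ) - 1 / 2)) *
      (theta (qPow τ x) (q τ) * theta (-qPow τ x) (q τ) *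
        theta (qPow τ (1 / 2) * qPow τ x) (q τ)) := by
  have h0 := ne_zero_of_im_pos hτ
  obtain ⟨κ, hκ⟩ := exists_theta_eq_mul_dualTheta hτ
  have hq := norm_q_lt_one hτ
  have hqt := norm_qt_lt_one hτ
  set p := qPow τ (1 / 2) with hp
  set r := qtPow τ (1 / 2) with hr
  have hp0 : p ≠ 0 := qPow_ne_zero _
  have hr0 : r ≠ 0 := Complex.exp_ne_zero _
  have hpq : p ^ 2 = q τ := qPow_half_sq
  have hrq : r ^ 2 = qt τ := qtPow_half_sq
  have ep : qPow τ (1 / 2 + -(1 / (2 * τ))) = -p := by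
    rw [qPow_add, qPow_neg_half_period hτ, mul_neg_one]
  have er : e (1 / 2 + -(1 / (2 * τ))) = -r := by
    rw [e_add, e_half, e_neg_half_period, neg_one_mul]
  have k1 := hκ (1 / 2)
  have k2 := hκ (-(1 / (2 * τ)))
  have k3 := hκ (1 / 2 + -(1 / (2 * τ)))
  have hnegr : theta (-r) (qt τ) = qPoch (-r) (qt τ) ^ 2 := by
    have := theta_of_sq (neg_ne_zero.2 hr0); rwa [neg_sq, hrq] at this
  have hnegp : theta (-p) (q τ) = qPoch (-p) (q τ) ^ 2 := by
    have := theta_of_sq (neg_ne_zero.2 hp0); rwa [neg_sq, hpq] at this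
  have hposr := theta_of_sq hr0
  have hposp := theta_of_sq hp0
  rw [hrq] at hposr
  rw [hpq] at hposp
  rw [dualTheta, e_half, theta_neg_one hqt, ← hp, hposp] at k1
  rw [dualTheta, e_neg_half_period, qPow_neg_half_period hτ, ← hr, hposr, theta_neg_one hq] at k2
  rw [dualTheta, er, ep, hnegr, hnegp] at k3
  have eu1 := euler_qPoch (norm_qPow_half_lt_one hτ)
  have eu2 := euler_qPoch (norm_qtPow_half_lt_one hτ)
  rw [← hp, hpq] at eu1
  rw [← hr, hrq] at eu2
  have hκ3 : κ ^ 3 = cexp (-(Real.pi * I * (3 / 2 - τ / 2 - 1 / (2 * τ)))) := by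
    rw [Complex.exp_neg]
    refine eq_inv_of_mul_eq_one_left ?_
    have e3 : cexp (Real.pi * I * (3 / 2 - τ / 2 - 1 / (2 * τ))) =
        cexp (Real.pi * I * (τ * (1 / 2) ^ 2 + (1 - τ) * (1 / 2))) *
        cexp (Real.pi * I * (τ * (-(1 / (2 * τ))) ^ 2 + (1 - τ) * -(1 / (2 * τ)))) *
        cexp (Real.pi * I * (τ * (1 / 2 + -(1 / (2 * τ))) ^ 2 +
          (1 - τ) * (1 / 2 + -(1 / (2 * τ))))) := by
      rw [← Complex.exp_add, ← Complex.exp_add]; congr 1; field_simp; ring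
    rw [e3]
    generalize cexp (Real.pi * I * (τ * (1 / 2) ^ 2 + (1 - τ) * (1 / 2))) = E1 at *
    generalize cexp (Real.pi * I * (τ * (-(1 / (2 * τ))) ^ 2 + (1 - τ) * -(1 / (2 * τ)))) = E2 at *
    generalize cexp (Real.pi * I * (τ * (1 / 2 + -(1 / (2 * τ))) ^ 2 +
      (1 - τ) * (1 / 2 + -(1 / (2 * τ))))) = E3 at *
    have hprod := congrArg₂ (· * ·) (congrArg₂ (· * ·) k1 k2) k3
    generalize qPoch (-q τ) (q τ) = a1 at *
    generalize qPoch p (q τ) = a2 at *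
    generalize qPoch (-p) (q τ) = a3 at *
    generalize qPoch (-qt τ) (qt τ) = b1 at *
    generalize qPoch r (qt τ) = b2 at *
    generalize qPoch (-r) (qt τ) = b3 at *
    have s1 : (a1 * (a2 * a3)) ^ 2 = 1 := by rw [eu1, one_pow]
    have s2 : (b1 * (b2 * b3)) ^ 2 = 1 := by rw [eu2, one_pow]
    linear_combination (-1 / 2 : ℂ) * hprod + s2 - κ ^ 3 * E1 * E2 * E3 * s1
  have x1 := hκ x
  have x2 := hκ (x + 1 / 2)
  have x3 := hκ (x + -(1 / (2 * τ)))
  rw [dualTheta, e_add, e_half, mul_neg_one, qPow_add, ← hp, mul_comm _ p] at x2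
  rw [dualTheta, e_add, e_neg_half_period, ← hr, mul_comm _ r, qPow_add, qPow_neg_half_period hτ,
    mul_neg_one] at x3
  rw [dualTheta] at x1
  rw [x1, x2, x3]
  have e4 : cexp (Real.pi * I *
      (3 * τ * x ^ 2 - 2 * τ * x + 2 * x + τ / 4 + 1 / (4 * τ) - 1 / 2)) =
      κ ^ 3 * (cexp (Real.pi * I * (τ * x ^ 2 + (1 - τ) * x)) *
      cexp (Real.pi * I * (τ * (x + 1 / 2) ^ 2 + (1 - τ) * (x + 1 / 2))) *
      cexp (Real.pi * I * (τ * (x + -(1 / (2 * τ))) ^ 2 + (1 - τ) * (x + -(1 / (2 * τ)))))) := by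
    rw [hκ3, ← Complex.exp_add, ← Complex.exp_add, ← Complex.exp_add]
    congr 1; field_simp; ring
  rw [e4]
  ring

end Theta

/-! ### The elementary form of the integrand -/

section Prefactor
variable {τ : ℂ}

theorem qPoch_mul_qPow_ne_zero (hτ : 0 < τ.im) {c x : ℝ} (h : ∀ j : ℕ, c + x + j ≠ 0) {a : ℂ}
    (ha : ‖a‖ = ‖qPow τ c‖) : qPoch (a * qPow τ x) (q τ) ≠ 0 := by
  refine qPoch_ne_zero (norm_q_lt_one hτ) fun j hj => ?_
  have hn : ‖a * qPow τ x * q τ ^ j‖ = Real.exp (-(2 * Real.pi * τ.im) * (c + x + j)) := by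
    rw [norm_mul, norm_mul, ha, norm_pow, norm_q, norm_qPow_ofReal, norm_qPow_ofReal,
      ← Real.exp_nat_mul, ← Real.exp_add, ← Real.exp_add]
    congr 1; ring
  rw [hj, norm_one, eq_comm, Real.exp_eq_one_iff] at hn
  have hl : -(2 * Real.pi * τ.im) ≠ 0 := by have := Real.pi_pos; simp; grind
  exact h j ((mul_eq_zero.1 hn).resolve_left hl)

theorem qPochPM_ne_zero (hτ : 0 < τ.im) {x : ℝ} (hx : ∀ n : ℤ, 2 * x ≠ n) {m : ℤ} {a : ℂ}
    (ha : ‖a‖ = ‖qPow τ ((m / 2 : ℝ) : ℂ)‖) : qPochPM τ a x ≠ 0 := by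
  refine mul_ne_zero (qPoch_mul_qPow_ne_zero hτ (fun j h => hx (-m - 2 * j) ?_) ha) ?_
  · push_cast; linarith
  · rw [← ofReal_neg]
    refine qPoch_mul_qPow_ne_zero hτ (fun j h => hx (m + 2 * j) ?_) ha
    push_cast; linarith

/-- The quotient of products independent of `s` and `t` is elementary. The points with `2x ∈ ℤ`, which
include all zeros of the denominator, are excluded. -/
theorem prefactor_eq (hτ : 0 < τ.im) {x : ℝ} (hx : ∀ n : ℤ, 2 * x ≠ n) :
    (qtPochPM τ 1 x * qtPochPM τ (-1) x * qtPochPM τ (qtPow τ (1 / 2)) x) /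
      (qPochPM τ (qPow τ 1) x * qPochPM τ (-qPow τ 1) x * qPochPM τ (qPow τ (1 / 2)) x) *
      qPow τ ((x : ℂ) ^ 2 / 2) =
    I * cexp (Real.pi * I / 4 * (τ + 1 / τ)) *
      (qPow τ (2 * (x : ℂ) ^ 2) * (qPow τ x - qPow τ (-x)) * (e x - e (-x))) := by
  have h0 := ne_zero_of_im_pos hτ
  have hq := norm_q_lt_one hτ
  have hqt := norm_qt_lt_one hτ
  have d1 : qPochPM τ (qPow τ 1) x ≠ 0 :=
    qPochPM_ne_zero hτ hx (m := 2) (by norm_num)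
  have d2 : qPochPM τ (-qPow τ 1) x ≠ 0 :=
    qPochPM_ne_zero hτ hx (m := 2) (by rw [norm_neg]; norm_num)
  have d3 : qPochPM τ (qPow τ (1 / 2)) x ≠ 0 :=
    qPochPM_ne_zero hτ hx (m := 1) (by push_cast; rfl)
  have hez := e_ne_zero (x : ℂ)
  have hqz := qPow_ne_zero (τ := τ) x
  have he : e (-(x : ℂ)) = (e x)⁻¹ := (inv_eq_of_mul_eq_one_right (e_mul_e_neg _)).symm
  have hqn := qPow_neg (τ := τ) x
  have n1 : qtPochPM τ 1 x = (1 - (e x)⁻¹) * theta (e x) (qt τ) := by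
    rw [qtPochPM, one_mul, one_mul, he, qPoch_eq_mul (e x)⁻¹ hqt, theta, mul_comm (qt τ)]; ring
  have n2 : qtPochPM τ (-1) x = (1 + (e x)⁻¹) * theta (-e x) (qt τ) := by
    rw [qtPochPM, neg_one_mul, neg_one_mul, he, qPoch_eq_mul (-(e x)⁻¹) hqt, theta, inv_neg,
      mul_comm (qt τ)]; ring
  have n3 : qtPochPM τ (qtPow τ (1 / 2)) x = theta (qtPow τ (1 / 2) * e x) (qt τ) := by
    have hr0 : qtPow τ (1 / 2) ≠ 0 := Complex.exp_ne_zero _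
    rw [qtPochPM, theta, he, ← qtPow_half_sq]; congr 2; field_simp
  have m1 : (1 - qPow τ x) * qPochPM τ (qPow τ 1) x = theta (qPow τ x) (q τ) := by
    rw [qPochPM, theta, qPoch_eq_mul (qPow τ x) hq, hqn, ← q, mul_comm (q τ) (qPow τ x)]; ring
  have m2 : (1 + qPow τ x) * qPochPM τ (-qPow τ 1) x = theta (-qPow τ x) (q τ) := by
    rw [qPochPM, theta, qPoch_eq_mul (-qPow τ x) hq, hqn, ← q, inv_neg,
      show -q τ * qPow τ x = -qPow τ x * q τ by ring,
      show -q τ * (qPow τ x)⁻¹ = q τ * -(qPow τ x)⁻¹ by ring]; ring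
  have m3 : qPochPM τ (qPow τ (1 / 2)) x = theta (qPow τ (1 / 2) * qPow τ x) (q τ) := by
    have hp0 : qPow τ (1 / 2) ≠ 0 := qPow_ne_zero _
    rw [qPochPM, theta, hqn, ← qPow_half_sq]; congr 2; field_simp
  have ht := theta_triple hτ x
  rw [← m1, ← m2, ← m3] at ht
  have hexp : cexp (Real.pi * I * (3 * τ * (x : ℂ) ^ 2 - 2 * τ * x + 2 * x + τ / 4 + 1 / (4 * τ) -
      1 / 2)) * qPow τ ((x : ℂ) ^ 2 / 2) =
      -I * cexp (Real.pi * I / 4 * (τ + 1 / τ)) * qPow τ (2 * (x : ℂ) ^ 2) * (qPow τ x)⁻¹ * e x := by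
    have hI : -I = cexp (-(Real.pi / 2 * I)) := by
      rw [Complex.exp_neg, Complex.exp_pi_div_two_mul_I, inv_I]
    rw [hI, ← hqn]
    simp only [qPow, e, ← Complex.exp_add]
    congr 1; field_simp; ring
  rw [n1, n2, n3, div_mul_eq_mul_div, div_eq_iff (mul_ne_zero (mul_ne_zero d1 d2) d3), he, hqn]
  calc _ = (1 - (e x)⁻¹) * (1 + (e x)⁻¹) * (theta (e x) (qt τ) * theta (-e x) (qt τ) *
        theta (qtPow τ (1 / 2) * e x) (qt τ)) * qPow τ ((x : ℂ) ^ 2 / 2) := by ring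
    _ = (1 - (e x)⁻¹) * (1 + (e x)⁻¹) * ((1 - qPow τ x) * (1 + qPow τ x)) *
        (cexp (Real.pi * I * (3 * τ * (x : ℂ) ^ 2 - 2 * τ * x + 2 * x + τ / 4 + 1 / (4 * τ) -
          1 / 2)) * qPow τ ((x : ℂ) ^ 2 / 2)) *
        (qPochPM τ (qPow τ 1) x * qPochPM τ (-qPow τ 1) x * qPochPM τ (qPow τ (1 / 2)) x) := by
        rw [ht]; ring
    _ = _ := by
        rw [hexp]; field_simp; ring

theorem integrand_eq (hτ : 0 < τ.im) (s t : Fin 4 → ℂ) {x : ℝ} (hx : ∀ n : ℤ, 2 * x ≠ n) :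
    integrand τ s t x = I * cexp (Real.pi * I / 4 * (τ + 1 / τ)) *
      (weight τ (s 0) (s 1) (s 2) (s 3) x *
        ((qPow τ x - qPow τ (-x)) * tPeriodic τ (t 0) (t 1) (t 2) (t 3) x)) := by
  rw [integrand, mul_right_comm, prefactor_eq hτ hx, Fin.prod_univ_four, weight, tPeriodic, tKernel]
  simp only [div_eq_mul_inv]
  ring

theorem ae_two_mul_ne_int : ∀ᵐ x : ℝ, ∀ n : ℤ, 2 * x ≠ n := by
  rw [ae_all_iff]
  intro n
  refine compl_mem_ae_iff.2 ?_
  refine measure_mono_null (t := {(n / 2 : ℝ)}) (fun x hx => ?_) (measure_singleton _)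
  have : 2 * x = n := hx
  rw [Set.mem_singleton_iff]; linarith

end Prefactor

theorem prod_Ioi_fin_four (f : Fin 4 → Fin 4 → ℂ) : ∏ k : Fin 4, ∏ m ∈ Finset.Ioi k, f k m =
    f 0 1 * f 0 2 * f 0 3 * (f 1 2 * f 1 3 * f 2 3) := by
  rw [Fin.prod_univ_four,
    show Finset.Ioi (0 : Fin 4) = {1, 2, 3} by decide,
    show Finset.Ioi (1 : Fin 4) = {2, 3} by decide,
    show Finset.Ioi (2 : Fin 4) = {3} by decide,
    show Finset.Ioi (3 : Fin 4) = ∅ by decide]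
  simp
  ring

end FusedAW

theorem proposition4p2 (τ : ℂ) (hτ : 0 < τ.im) (s t : Fin 4 → ℂ)
    (hs : ‖FusedAW.qPow τ (-3) * (s 0 * s 1 * s 2 * s 3)‖ < 1)
    (ht : ∀ k, ‖t k‖ < 1) :
    MeasureTheory.Integrable (FusedAW.integrand τ s t) ∧
    ∫ x : ℝ, FusedAW.integrand τ s t x =
      2 / (-Complex.I * τ) ^ (1 / 2 : ℂ) *
        (FusedAW.qPoch (t 0 * t 1 * t 2 * t 3) (FusedAW.qt τ) /
          FusedAW.qPoch (FusedAW.qPow τ (-3) * (s 0 * s 1 * s 2 * s 3)) (FusedAW.q τ)) *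
        ∏ k : Fin 4, ∏ m ∈ Finset.Ioi k,
          FusedAW.qPoch (FusedAW.qPow τ (-1) * s k * s m) (FusedAW.q τ) /
            FusedAW.qPoch (t k * t m) (FusedAW.qt τ) := by
  have hcont := FusedAW.continuous_tPeriodic hτ (ht 0) (ht 1) (ht 2) (ht 3)
  obtain ⟨M, hM⟩ := FusedAW.exists_norm_tPeriodic_le hτ
    (r := max (max ‖t 0‖ ‖t 1‖) (max ‖t 2‖ ‖t 3‖)) (by simp [ht])
  have hM := hM (t 0) (t 1) (t 2) (t 3) (by simp) (by simp) (by simp) (by simp)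
  have hae : FusedAW.integrand τ s t =ᵐ[MeasureTheory.volume] fun x =>
      Complex.I * Complex.exp (Real.pi * Complex.I / 4 * (τ + 1 / τ)) *
      (FusedAW.weight τ (s 0) (s 1) (s 2) (s 3) x *
        ((FusedAW.qPow τ x - FusedAW.qPow τ (-x)) *
          FusedAW.tPeriodic τ (t 0) (t 1) (t 2) (t 3) x)) := by
    filter_upwards [FusedAW.ae_two_mul_ne_int] with x hx using FusedAW.integrand_eq hτ s t hx
  refine ⟨((FusedAW.integrable_sIntegral hτ hcont hM hs).const_mul _).congr hae.symm, ?_⟩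
  have hS := FusedAW.sIntegral_eq hτ hcont hM (FusedAW.periodic_tPeriodic _ _ _ _) hs
  have hT := FusedAW.tIntegral_eq hτ (ht 0) (ht 1) (ht 2) (ht 3)
  have hnt : ∀ k m, FusedAW.qPoch (t k * t m) (FusedAW.qt τ) ≠ 0 := fun k m =>
    FusedAW.qPoch_ne_zero_of_norm_lt (FusedAW.norm_qt_lt_one hτ) (by
      rw [norm_mul]
      exact mul_lt_one_of_nonneg_of_lt_one_left (norm_nonneg _) (ht k) (ht m).le)
  have hns := FusedAW.qPoch_ne_zero_of_norm_lt (FusedAW.norm_q_lt_one hτ) hs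
  have hcpow : (-Complex.I * τ) ^ (1 / 2 : ℂ) ≠ 0 := by
    have := FusedAW.ne_zero_of_im_pos hτ
    simp [Complex.cpow_eq_zero_iff, this]
  have hexp : Complex.exp (Real.pi * Complex.I / 4 * (τ + 1 / τ)) *
      Complex.exp (-(Real.pi * Complex.I / 4) * (τ + 1 / τ)) = 1 := by
    rw [← Complex.exp_add, ← Complex.exp_zero]; congr 1; ring
  rw [MeasureTheory.integral_congr_ae hae, MeasureTheory.integral_const_mul]
  change _ * FusedAW.sIntegral τ (FusedAW.tPeriodic τ (t 0) (t 1) (t 2) (t 3))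
    (s 0) (s 1) (s 2) (s 3) = _
  rw [FusedAW.sIntegral_zero, ← FusedAW.tIntegral] at hS
  rw [FusedAW.tIntegral_zero hτ] at hT
  rw [FusedAW.prod_Ioi_fin_four]
  have h01 := hnt 0 1
  have h02 := hnt 0 2
  have h03 := hnt 0 3
  have h12 := hnt 1 2
  have h13 := hnt 1 3
  have h23 := hnt 2 3
  have hS' := eq_div_of_mul_eq hns ((mul_comm _ _).trans hS)
  have hT' := eq_div_of_mul_eq (mul_ne_zero (mul_ne_zero (mul_ne_zero h01 h02) h03)
    (mul_ne_zero (mul_ne_zero h12 h13) h23)) ((mul_comm _ _).trans hT)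
  have hconst : Complex.I * Complex.exp (Real.pi * Complex.I / 4 * (τ + 1 / τ)) *
      (-2 * Complex.I * Complex.exp (-(Real.pi * Complex.I / 4) * (τ + 1 / τ)) /
        (-Complex.I * τ) ^ (1 / 2 : ℂ)) = 2 / (-Complex.I * τ) ^ (1 / 2 : ℂ) := by
    rw [mul_div_assoc']
    congr 1
    linear_combination -2 * Complex.I ^ 2 * hexp - 2 * Complex.I_sq
  rw [hS', hT', ← hconst]
  simp only [div_eq_mul_inv, mul_inv]
  ring
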